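/- Let $g=\frac{\sqrt5-1}{2}$, $G=\frac{\sqrt5+1}{2}$, let $\alpha\in[g,G]$ and $I_\alpha=[\alpha-2,\alpha)$, with Borel $\sigma$-algebra $\mathcal B$. Let $\varphi_\alpha:I_\alpha\to I_\alpha$ be the map with $\varphi_\alpha(0)=0$ and $$\varphi_\alpha(x)=\frac1{|x|}-d_\alpha(x),\qquad d_\alpha(x)=2\left\lfloor\frac1{2|x|}+\frac{1-\alpha}2\right\rfloor+1\qquad(x\neq0).$$ Let $$\Omega_\alpha=I_\alpha\times[0,2-G)\ \cup\ \left(\tfrac{1-\alpha}{\alpha},\alpha\right)\times(2-G,1]\ \cup\ \left[\tfrac{\alpha-1}{2-\alpha},\alpha\right)\times[1,G)$$ (intervals whose left endpoint is not smaller than the right one are empty), let $\mu_\alpha$ be the measure on $\Omega_\alpha$ with $d\mu_\alpha=(1+xy)^{-2}\,dx\,dy$, and for $E\in\mathcal B$ put $$\nu_\alpha(E)=\frac1{3\log G}\,\mu_\alpha\big(\{(x,y)\in\Omega_\alpha: x\in E\}\big).$$ Then $\nu_\alpha$ is a probability measure on $(I_\alpha,\mathcal B)$, it is invariant under $\varphi_\alpha$,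 and the measure-preserving system $(I_\alpha,\mathcal B,\varphi_\alpha,\nu_\alpha)$ is ergodic: every $A\in\mathcal B$ with $\varphi_\alpha^{-1}(A)=A$ satisfies $\nu_\alpha(A)=0$ or $\nu_\alpha(I_\alpha\setminus A)=0$. -/

import Mathlib

namespace AlphaOCF

/-- The small golden ratio `g = (√5 - 1) / 2`. -/
noncomputable def g : ℝ := (Real.sqrt 5 - 1) / 2

/-- The golden ratio `G = (√5 + 1) / 2`. -/
noncomputable def G : ℝ := (Real.sqrt 5 + 1) / 2

/-- The interval `I_α = [α - 2, α)`. -/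
def I (α : ℝ) : Set ℝ := Set.Ico (α - 2) α

/-- The digit function `d_α(x) = 2 ⌊1 / (2|x|) + (1 - α) / 2⌋ + 1` (used only for `x ≠ 0`). -/
noncomputable def digit (α x : ℝ) : ℤ := 2 * ⌊1 / (2 * |x|) + (1 - α) / 2⌋ + 1

/-- The formula of the Gauss map: `0 ↦ 0` and `x ↦ 1 / |x| - d_α(x)` for `x ≠ 0`. -/
noncomputable def gaussFun (α x : ℝ) : ℝ :=
  if x = 0 then 0 else 1 / |x| - (digit α x : ℝ)

theorem gaussFun_mem {α : ℝ} (hα : α ∈ Set.Icc g G) (x : ℝ) : gaussFun α x ∈ I α := by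
  have h5 : Real.sqrt 5 * Real.sqrt 5 = 5 := Real.mul_self_sqrt (by norm_num)
  have h0 : 0 ≤ Real.sqrt 5 := Real.sqrt_nonneg 5
  obtain ⟨h1, h2⟩ := hα
  unfold g at h1
  unfold G at h2
  unfold gaussFun I
  split_ifs with hx
  · constructor <;> nlinarith
  · have ha : |x| ≠ 0 := abs_ne_zero.mpr hx
    have he : 1 / (2 * |x|) = 1 / |x| / 2 := by field_simp
    have hl := Int.floor_le (1 / (2 * |x|) + (1 - α) / 2)
    have hu := Int.lt_floor_add_one (1 / (2 * |x|) + (1 - α) / 2)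
    rw [he] at hl hu
    unfold digit
    rw [he]
    push_cast
    constructor <;> linarith

/-- The Gauss map `φ_α : I_α → I_α` of the `α`-expansions with odd partial quotients. -/
noncomputable def gaussMap (α : ℝ) (hα : α ∈ Set.Icc g G) : I α → I α :=
  fun x => ⟨gaussFun α x, gaussFun_mem hα x⟩

/-- The natural extension domain `Ω_α`, a union of three rectangles. The endpoints
`(1 - α) / α` and `(α - 1) / (2 - α)` are `φ_α(α)` and `φ_α(α - 2)` for `g < α < G`
(there the digits of `α` and `α - 2` are both `1`). The same expressions serve `α = g`, where
the second rectangle is empty, and `α = G`, where the third one is empty. -/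
def Omega (α : ℝ) : Set (ℝ × ℝ) :=
  I α ×ˢ Set.Ico 0 (2 - G) ∪
    Set.Ioo ((1 - α) / α) α ×ˢ Set.Ioc (2 - G) 1 ∪
    Set.Ico ((α - 1) / (2 - α)) α ×ˢ Set.Ico 1 G

/-- The measure `μ_α` on `Ω_α` with density `(1 + x y)⁻²` (as a measure on the plane
which vanishes outside `Ω_α`). -/
noncomputable def mu (α : ℝ) : MeasureTheory.Measure (ℝ × ℝ) :=
  (MeasureTheory.volume.restrict (Omega α)).withDensity
    (fun p => ENNReal.ofReal (1 / (1 + p.1 * p.2) ^ 2))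

/-- The normalized measure `(3 log G)⁻¹ μ_α`. -/
noncomputable def muNormalized (α : ℝ) : MeasureTheory.Measure (ℝ × ℝ) :=
  ENNReal.ofReal (3 * Real.log G)⁻¹ • mu α

/-- The measure `ν_α` on the Borel sets of `I_α`: the image of the normalized measure on `Ω_α`
under `(x, y) ↦ x`, that is `ν_α(E) = (3 log G)⁻¹ μ_α {(x, y) ∈ Ω_α : x ∈ E}`. -/
noncomputable def nu (α : ℝ) : MeasureTheory.Measure (I α) :=
  ((muNormalized α).map Prod.fst).comap Subtype.val

end AlphaOCF

namespace AlphaOCF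

/-! Invariance. Integrating `(1 + x y)⁻²` over the fibres of `Omega α` gives an explicit density, a
sum of terms `1 / (x + u)` switched on at the images of the two endpoints of `I α`
(`lintegral_fiber`). It suffices that this density is fixed by the transfer operator
(`tsum_transferTerm`). The branches `x = 1 / D` and `x = -1 / (D + 2)` together contribute `1 / D -
1 / (D + 2)`, so the sum over digits telescopes; only the smallest digits, where an inverse branch
may leave `I α`, need separate care, and they reproduce the switches of the density. Integrating the
density once more gives `3 log G`, since the logarithms depending on `α` cancel (`marginal_univ`).

Ergodicity. An invariant set lifts to a `2`-periodic set `B` of reals. Modulo `2` the Gauss map is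
`x ↦ 1 / |x| + 1`, so `B` is preserved by it on the irrational points of `I α`. Matching of two
orbits after one more step yields symmetry under `x ↦ -x` (`neg_iff`), and then invariance under `x
↦ 1 / x + 1` on all irrationals (`inv_iff`). These symmetries suffice to run a Euclidean algorithm,
so every rational is the image of `∞` under an integral Möbius map of determinant `±1` preserving
`B` (`isCuspOf_of_isCoprime`).

The zero-one law `IsGaussInvariant.volume_eq_zero_or` follows by Lebesgue density. Near an
irrational density point of `B` take `p / q` at distance less than `q⁻²`. The Möbius map sending `∞`
to `p / q` carries a full period of `Bᶜ` into a neighbourhood of size about `q⁻²`, with mass at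
least a fixed multiple of `q⁻²`. Unless `Bᶜ` is null, this contradicts density as `q` grows. -/

theorem G_sq : G ^ 2 = G + 1 := by
  have h5 : Real.sqrt 5 ^ 2 = 5 := Real.sq_sqrt (by norm_num)
  unfold G
  linear_combination (1 / 4) * h5

theorem g_eq : g = G - 1 := by
  unfold g G
  ring

theorem lt_G : 1.618 < G := by
  have : (2.236 : ℝ) < Real.sqrt 5 := Real.lt_sqrt_of_sq_lt (by norm_num)
  unfold G
  linarith

theorem G_lt : G < 1.6181 := by
  have : Real.sqrt 5 < (2.2362 : ℝ) := (Real.sqrt_lt' (by norm_num)).2 (by norm_num)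
  unfold G
  linarith

theorem sq_le_of_mem {α : ℝ} (hα : α ∈ Set.Icc g G) : α ^ 2 ≤ α + 1 := by
  obtain ⟨h1, h2⟩ := hα
  rw [g_eq] at h1
  nlinarith [G_sq, lt_G]

theorem one_le_of_mem {α : ℝ} (hα : α ∈ Set.Icc g G) : 1 ≤ α ^ 2 + α := by
  obtain ⟨h1, h2⟩ := hα
  rw [g_eq] at h1
  nlinarith [G_sq, lt_G]

/-! ### Symmetries of the lifted invariant set -/

/-- A set of reals which is `2`-periodic and such that membership of irrational points of `I α`
is preserved by `x ↦ 1 / |x| + 1`. -/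
structure IsGaussInvariant (α : ℝ) (B : Set ℝ) : Prop where
  add_two : ∀ x, x + 2 ∈ B ↔ x ∈ B
  step : ∀ x ∈ I α, Irrational x → (x ∈ B ↔ 1 / |x| + 1 ∈ B)

namespace IsGaussInvariant

variable {α : ℝ} {B : Set ℝ}

theorem add_int (h : IsGaussInvariant α B) (x : ℝ) (n : ℤ) : x + 2 * n ∈ B ↔ x ∈ B := by
  induction n using Int.induction_on with
  | zero => simp
  | succ k ih =>
    rw [← ih, ← h.add_two (x + 2 * (k : ℤ))]
    push_cast
    ring_nf
  | pred k ih =>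
    rw [← ih, ← h.add_two (x + 2 * ((-(k : ℤ) - 1 : ℤ) : ℝ))]
    push_cast
    ring_nf

/-- Two reals differing by `2` lie in `B` simultaneously. -/
theorem iff_of_eq_add_two (h : IsGaussInvariant α B) {x y : ℝ} (hxy : x = y + 2) :
    x ∈ B ↔ y ∈ B := by
  rw [hxy, h.add_two]

theorem exists_add_int_mem_I (α x : ℝ) : ∃ n : ℤ, x + 2 * n ∈ I α := by
  refine ⟨-⌊(x - α) / 2⌋ - 1, ?_⟩
  have h1 := Int.floor_le ((x - α) / 2)
  have h2 := Int.lt_floor_add_one ((x - α) / 2)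
  push_cast
  constructor <;> linarith

/-- One step from the two points leads to `1 / (1 - t)` and `1 / (1 - t) + 2`, which agree modulo
`2`. -/
theorem matching (h : IsGaussInvariant α B) {t : ℝ} (ht : Irrational t) (ht0 : 0 < t)
    (ht1 : t < 1) (hs : 1 / t - 1 ∈ I α) (hs' : 1 / (2 - t) - 1 ∈ I α) :
    1 / t - 1 ∈ B ↔ 1 / (2 - t) - 1 ∈ B := by
  have hi : Irrational (1 / t - 1) := by
    simpa using (ht.inv.sub_natCast 1)
  have hi' : Irrational (1 / (2 - t) - 1) := by
    simpa using ((ht.natCast_sub 2).inv.sub_natCast 1)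
  have e : 1 / t - 1 = (1 - t) / t := by field_simp
  have e' : 1 / (2 - t) - 1 = -((1 - t) / (2 - t)) := by
    have : 2 - t ≠ 0 := by linarith
    field_simp
    ring
  rw [h.step _ hs hi, h.step _ hs' hi']
  symm
  apply h.iff_of_eq_add_two
  rw [e, e', abs_neg, abs_of_pos (by apply div_pos <;> linarith),
    abs_of_pos (by apply div_pos <;> linarith)]
  have : 1 - t ≠ 0 := by linarith
  field_simp
  ring

/-- If `t` and `-t` both lie in `I α`, they have the same image. Otherwise the one outside is
shifted by `2` into `I α`, and the two images agree after a further step by `matching`. The bounds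
`g ≤ α ≤ G` keep the intermediate points in `I α`. -/
theorem neg_of_mem_Ioo (h : IsGaussInvariant α B) (hα : α ∈ Set.Icc g G) {t : ℝ}
    (ht0 : 0 < t) (ht1 : t < 1) (hi : Irrational t) : t ∈ B ↔ -t ∈ B := by
  have hsq := sq_le_of_mem hα
  have hsq' := one_le_of_mem hα
  have hα0 : 0.6 < α := by have := hα.1; rw [g_eq] at this; linarith [lt_G]
  have hα2 : α < 1.7 := by linarith [hα.2, G_lt]
  have hi2 : Irrational (2 - t) := by simpa using hi.natCast_sub 2
  have hB1 : ∀ s : ℝ, 1 / s + 1 ∈ B ↔ 1 / s - 1 ∈ B := fun s =>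
    h.iff_of_eq_add_two (by ring)
  have e1 : 1 < 1 / t := by rw [lt_div_iff₀ ht0]; linarith
  have e2 : 1 / (2 - t) < 1 := by rw [div_lt_one (by linarith)]; linarith
  have a1 : |t| = t := abs_of_pos ht0
  have a2 : |2 - t| = 2 - t := abs_of_pos (by linarith)
  have hm : t - 2 ∈ B ↔ t ∈ B := (h.iff_of_eq_add_two (by ring)).symm
  have hm' : 2 - t ∈ B ↔ -t ∈ B := h.iff_of_eq_add_two (by ring)
  rcases le_or_gt α 1 with hα1 | hα1
  · rcases lt_or_ge t α with hta | hta
    · rw [h.step t ⟨by linarith, hta⟩ hi, h.step (-t) ⟨by linarith, by linarith⟩ hi.neg, abs_neg]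
    · rw [h.step (-t) ⟨by linarith, by linarith⟩ hi.neg, abs_neg, a1, hB1]
      have hp : 1 ≤ (α + 1) * t := by nlinarith
      -- Equality occurs only for `t = α = g`; there `1 / t - 1 = t`, so nothing is left to match.
      rcases hp.eq_or_lt with hp | hp
      · have hta' : t = α := by nlinarith
        have : 1 / t - 1 = t := by
          field_simp
          rw [hta'] at hp ⊢
          linarith
        rw [this]
      · rw [← hm, h.step (t - 2) ⟨by linarith, by linarith⟩ (by simpa using hi.sub_natCast 2),
          abs_sub_comm, a2, hB1, ← h.matching hi ht0 ht1 ⟨by linarith, ?_⟩ ⟨?_, by linarith⟩]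
        · rw [sub_lt_iff_lt_add, div_lt_iff₀ ht0]
          exact hp
        · have : 0 < 1 / (2 - t) := by apply div_pos <;> linarith
          linarith
  · rcases le_or_gt t (2 - α) with hta | hta
    · rw [h.step t ⟨by linarith, by linarith⟩ hi,
        h.step (-t) ⟨by linarith, by linarith⟩ hi.neg, abs_neg]
    · rw [← hm', h.step t ⟨by linarith, by linarith⟩ hi, h.step (2 - t) ⟨by linarith, by linarith⟩ hi2,
        a1, a2, hB1, hB1, h.matching hi ht0 ht1 ⟨by linarith, ?_⟩ ⟨?_, by linarith⟩]
      · rw [sub_lt_iff_lt_add, div_lt_iff₀ ht0]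
        nlinarith
      · have : α - 1 ≤ 1 / (2 - t) := by
          rw [le_div_iff₀ (by linarith)]
          nlinarith
        linarith

/-- A Gauss invariant set is symmetric on the irrationals. -/
theorem neg_iff (h : IsGaussInvariant α B) (hα : α ∈ Set.Icc g G) {x : ℝ} (hi : Irrational x) :
    x ∈ B ↔ -x ∈ B := by
  obtain ⟨n, hn1, hn2⟩ := exists_add_int_mem_I 1 x
  have hi' : Irrational (x + 2 * n) := by
    simpa using hi.add_intCast (2 * n)
  have e : -x = -(x + 2 * n) + 2 * n := by ring
  suffices key : x + 2 * n ∈ B ↔ -(x + 2 * n) ∈ B by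
    rw [← h.add_int x n, key, e, h.add_int _ n]
  rcases lt_trichotomy (x + 2 * n) 0 with h0 | h0 | h0
  · have hne : x + 2 * n ≠ -1 := by
      have := hi'.ne_int (-1)
      simpa using this
    have hlt : -1 < x + 2 * n := lt_of_le_of_ne (by linarith) hne.symm
    have := h.neg_of_mem_Ioo hα (t := -(x + 2 * n)) (by linarith) (by linarith) hi'.neg
    rw [neg_neg] at this
    exact this.symm
  · exact absurd h0 hi'.ne_zero
  · exact h.neg_of_mem_Ioo hα h0 hn2 hi'

/-- On `I α` the absolute value is removed by symmetry, and at least one of `x`, `-x` lies in `I α`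
when `|x| < 1`. -/
theorem inv_of_abs_lt_one (h : IsGaussInvariant α B) (hα : α ∈ Set.Icc g G) {x : ℝ}
    (hx : |x| < 1) (hi : Irrational x) : x ∈ B ↔ 1 / x + 1 ∈ B := by
  have aux : ∀ x : ℝ, x ∈ I α → Irrational x → (x ∈ B ↔ 1 / x + 1 ∈ B) := by
    intro x hx hi
    rw [h.step x hx hi]
    rcases le_or_gt 0 x with h0 | h0
    · rw [abs_of_nonneg h0]
    · rw [abs_of_neg h0, h.neg_iff hα (by simpa using hi.neg.inv.add_natCast 1)]
      symm
      apply h.iff_of_eq_add_two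
      rw [div_neg]
      ring
  obtain ⟨h1, h2⟩ := abs_lt.1 hx
  by_cases hm : x ∈ I α
  · exact aux x hm hi
  have hm' : -x ∈ I α := by
    by_contra hm'
    unfold I at hm hm'
    rw [Set.mem_Ico, not_and, not_lt] at hm hm'
    rcases le_or_gt (α - 2) x with ha | ha
    · have := hm ha
      have := hm' (by linarith)
      have := hα.1
      rw [g_eq] at this
      linarith [lt_G]
    · have := hm' (by linarith [hα.2, G_lt])
      linarith
  rw [h.neg_iff hα hi, aux _ hm' hi.neg, h.neg_iff hα (by simpa using hi.neg.inv.add_natCast 1)]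
  symm
  apply h.iff_of_eq_add_two
  rw [div_neg]
  ring

/-- Up to signs and shifts by `2`, the chain `1 / x + 1`, `1 - 1 / x`, `1 / (x - 1)`, `x` uses
inversion only at points of modulus below `1`. -/
theorem inv_of_two_lt (h : IsGaussInvariant α B) (hα : α ∈ Set.Icc g G) {x : ℝ}
    (hx : 2 < x) (hi : Irrational x) : x ∈ B ↔ 1 / x + 1 ∈ B := by
  have hi1 : Irrational (1 / x - 1) := by simpa using hi.inv.sub_natCast 1
  have hi2 : Irrational (1 / (x - 1)) := by simpa using (hi.sub_natCast 1).inv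
  have hx1 : 0 < x - 1 := by linarith
  have h1 : 1 / x + 1 ∈ B ↔ 1 - 1 / x ∈ B := by
    rw [h.iff_of_eq_add_two (show 1 / x + 1 = 1 / x - 1 + 2 by ring), h.neg_iff hα hi1, neg_sub]
  have h2 : 1 - 1 / x ∈ B ↔ 1 / (x - 1) ∈ B := by
    have e : 1 - 1 / x = (x - 1) / x := by field_simp
    rw [h.inv_of_abs_lt_one hα _ (by simpa using hi.inv.natCast_sub 1)]
    · apply h.iff_of_eq_add_two
      rw [e]
      field_simp
      ring
    · rw [e, abs_of_pos (by positivity), div_lt_one (by linarith)]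
      linarith
  have h3 : 1 / (x - 1) ∈ B ↔ x ∈ B := by
    rw [h.inv_of_abs_lt_one hα _ hi2]
    · rw [one_div_one_div, sub_add_cancel]
    · rw [abs_of_pos (by positivity), div_lt_one (by linarith)]
      linarith
  rw [h1, h2, h3]

theorem inv_of_one_lt_of_lt_two (h : IsGaussInvariant α B) (hα : α ∈ Set.Icc g G) {x : ℝ}
    (h1 : 1 < x) (h2 : x < 2) (hi : Irrational x)
    (hy : (x - 1) / (2 - x) ∈ B ↔ 1 / ((x - 1) / (2 - x)) + 1 ∈ B) :
    x ∈ B ↔ 1 / x + 1 ∈ B := by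
  have hx1 : 0 < x - 1 := by linarith
  have hx2 : 0 < 2 - x := by linarith
  have hi1 : Irrational (1 / x - 1) := by simpa using hi.inv.sub_natCast 1
  have hi2 : Irrational (2 - x) := by simpa using hi.natCast_sub 2
  have c1 : x ∈ B ↔ 2 - x ∈ B := by
    rw [h.neg_iff hα hi]
    exact (h.iff_of_eq_add_two (by ring)).symm
  have c2 : 2 - x ∈ B ↔ (x - 1) / (2 - x) ∈ B := by
    rw [h.inv_of_abs_lt_one hα _ hi2]
    · apply h.iff_of_eq_add_two
      field_simp
      ring
    · rw [abs_of_pos hx2]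
      linarith
  have c3 : 1 / x + 1 ∈ B ↔ 1 - 1 / x ∈ B := by
    rw [h.iff_of_eq_add_two (show 1 / x + 1 = 1 / x - 1 + 2 by ring), h.neg_iff hα hi1, neg_sub]
  have c4 : 1 - 1 / x ∈ B ↔ 1 / ((x - 1) / (2 - x)) + 1 ∈ B := by
    have e : 1 - 1 / x = (x - 1) / x := by field_simp
    rw [h.inv_of_abs_lt_one hα _ (by simpa using hi.inv.natCast_sub 1)]
    · apply h.iff_of_eq_add_two
      rw [e]
      field_simp
      ring
    · rw [e, abs_of_pos (by positivity), div_lt_one (by linarith)]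
      linarith
  rw [c1, c2, hy, c3, c4]

/-- On `(1, 2)` the claim for `x` reduces to the claim for `(x - 1) / (2 - x)`. This map fixes `G`
and at least doubles the distance to it, so `n` bounds the number of steps before the orbit leaves
`(1, 2)`. -/
theorem inv_of_one_lt (h : IsGaussInvariant α B) (hα : α ∈ Set.Icc g G) (n : ℕ) :
    ∀ x : ℝ, 1 < x → Irrational x → 1 < 2 ^ n * |x - G| → (x ∈ B ↔ 1 / x + 1 ∈ B) := by
  induction n with
  | zero =>
    intro x hx hi hn
    rcases lt_or_ge x 2 with h2 | h2
    · rw [pow_zero, one_mul, lt_abs] at hn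
      rcases hn with hn | hn <;> linarith [lt_G, G_lt]
    · exact h.inv_of_two_lt hα (lt_of_le_of_ne h2 (by simpa using (hi.ne_nat 2).symm)) hi
  | succ n ih =>
    intro x hx hi hn
    rcases lt_or_ge x 2 with h2 | h2
    · have hx1 : 0 < x - 1 := by linarith
      have hx2 : 0 < 2 - x := by linarith
      have hiy : Irrational ((x - 1) / (2 - x)) := by
        have e : (x - 1) / (2 - x) = 1 / (2 - x) - 1 := by
          field_simp
          ring
        rw [e]
        have hi2 : Irrational (2 - x) := by simpa using hi.natCast_sub 2
        simpa using hi2.inv.sub_natCast 1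
      have hy0 : 0 < (x - 1) / (2 - x) := by positivity
      apply h.inv_of_one_lt_of_lt_two hα hx h2 hi
      rcases lt_trichotomy ((x - 1) / (2 - x)) 1 with h1 | h1 | h1
      · exact h.inv_of_abs_lt_one hα (by rwa [abs_of_pos hy0]) hiy
      · exact absurd h1 hiy.ne_one
      · apply ih _ h1 hiy
        have e : (x - 1) / (2 - x) - G = (x - G) * (G ^ 2 / (2 - x)) := by
          field_simp
          have h3 : G ^ 3 = 2 * G + 1 := by
            linear_combination (G + 1) * G_sq
          linear_combination h3 - x * G_sq
        have hG : 2 ≤ G ^ 2 / (2 - x) := by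
          rw [le_div_iff₀ hx2, G_sq]
          linarith [lt_G]
        rw [e, abs_mul, abs_of_pos (a := G ^ 2 / (2 - x)) (by linarith)]
        have : 0 ≤ 2 ^ n * |x - G| := by positivity
        rw [pow_succ] at hn
        nlinarith
    · exact h.inv_of_two_lt hα (lt_of_le_of_ne h2 (by simpa using (hi.ne_nat 2).symm)) hi

/-- A Gauss invariant set is invariant under `x ↦ 1 / x + 1` on the irrationals. -/
theorem inv_iff (h : IsGaussInvariant α B) (hα : α ∈ Set.Icc g G) {x : ℝ} (hi : Irrational x) :
    x ∈ B ↔ 1 / x + 1 ∈ B := by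
  have aux : ∀ x : ℝ, 1 < x → Irrational x → (x ∈ B ↔ 1 / x + 1 ∈ B) := by
    intro x hx hi
    by_cases hxG : x = G
    · have : 1 / x + 1 = x := by
        rw [hxG]
        have : G ≠ 0 := by linarith [lt_G]
        field_simp
        linarith [G_sq]
      rw [this]
    · have hpos : 0 < |x - G| := abs_pos.2 (sub_ne_zero.2 hxG)
      obtain ⟨n, hn⟩ := pow_unbounded_of_one_lt (1 / |x - G|) (one_lt_two (α := ℝ))
      exact h.inv_of_one_lt hα n x hx hi (by rwa [div_lt_iff₀ hpos] at hn)
  rcases lt_trichotomy |x| 1 with h1 | h1 | h1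
  · exact h.inv_of_abs_lt_one hα h1 hi
  · rcases eq_or_eq_neg_of_abs_eq h1 with rfl | rfl
    · exact absurd rfl hi.ne_one
    · exact absurd (by simp) (hi.ne_int (-1))
  · rcases lt_abs.1 h1 with h1 | h1
    · exact aux x h1 hi
    · rw [h.neg_iff hα hi, aux _ h1 hi.neg,
        h.neg_iff hα (by simpa using hi.neg.inv.add_natCast 1)]
      symm
      apply h.iff_of_eq_add_two
      rw [div_neg]
      ring

end IsGaussInvariant
end AlphaOCF
-- All cusps are equivalent to infinity
namespace AlphaOCF
open MeasureTheory Set Filter Topology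

/-- The cusp `p / q` is reached from `∞` by an integral Möbius transformation of determinant `±1`
which preserves membership in `B` on the irrationals. -/
def IsCuspOf (B : Set ℝ) (p q : ℤ) : Prop :=
  ∃ r s : ℤ, (p * s - q * r) ^ 2 = 1 ∧ ∀ y : ℝ, Irrational y →
    Irrational ((p * y + r) / (q * y + s)) ∧ (y ∈ B ↔ (p * y + r) / (q * y + s) ∈ B)

namespace IsGaussInvariant

variable {α : ℝ} {B : Set ℝ}

theorem isCuspOf_infinity (h : IsGaussInvariant α B) (hα : α ∈ Set.Icc g G) {p : ℤ}
    (hp : p = 1 ∨ p = -1) : IsCuspOf B p 0 := by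
  refine ⟨0, 1, by rcases hp with rfl | rfl <;> norm_num, fun y hy => ?_⟩
  rcases hp with rfl | rfl
  · simpa using hy
  · simpa using ⟨hy, h.neg_iff hα hy⟩

theorem isCuspOf_add_mul (h : IsGaussInvariant α B) {p q : ℤ} (n : ℤ)
    (hpq : IsCuspOf B p q) : IsCuspOf B (p + 2 * n * q) q := by
  obtain ⟨r, s, hdet, hy⟩ := hpq
  refine ⟨r + 2 * n * s, s, by rw [← hdet]; ring, fun y hi => ?_⟩
  obtain ⟨h1, h2⟩ := hy y hi
  have h0 : q * y + s ≠ 0 := by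
    intro h0
    rw [h0, div_zero] at h1
    exact h1.ne_zero rfl
  have e : (((p + 2 * n * q : ℤ) : ℝ) * y + ((r + 2 * n * s : ℤ) : ℝ)) / (q * y + s) =
      (p * y + r) / (q * y + s) + 2 * n := by
    push_cast
    field_simp
    ring
  rw [e, h.add_int]
  exact ⟨by simpa using h1.add_intCast (2 * n), h2⟩

theorem isCuspOf_neg (h : IsGaussInvariant α B) (hα : α ∈ Set.Icc g G) {p q : ℤ}
    (hpq : IsCuspOf B p q) : IsCuspOf B (-p) q := by
  obtain ⟨r, s, hdet, hy⟩ := hpq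
  refine ⟨-r, s, by rw [← hdet]; ring, fun y hi => ?_⟩
  obtain ⟨h1, h2⟩ := hy y hi
  have e : (((-p : ℤ) : ℝ) * y + ((-r : ℤ) : ℝ)) / (q * y + s) =
      -((p * y + r) / (q * y + s)) := by
    push_cast
    ring
  rw [e, ← h.neg_iff hα h1]
  exact ⟨h1.neg, h2⟩

/-- Compose with `w ↦ 1 / (w + 1)`; applying `inv_iff` to the new point returns `w + 2`. -/
theorem isCuspOf_add (h : IsGaussInvariant α B) (hα : α ∈ Set.Icc g G) {p q : ℤ}
    (hpq : IsCuspOf B p q) : IsCuspOf B q (p + q) := by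
  obtain ⟨r, s, hdet, hy⟩ := hpq
  refine ⟨s, r + s, by rw [← hdet]; ring, fun y hi => ?_⟩
  obtain ⟨h1, h2⟩ := hy y hi
  have h0 : q * y + s ≠ 0 := by
    intro h0
    rw [h0, div_zero] at h1
    exact h1.ne_zero rfl
  have e : (q * y + s) / (((p + q : ℤ) : ℝ) * y + ((r + s : ℤ) : ℝ)) =
      1 / ((p * y + r) / (q * y + s) + 1) := by
    rw [div_add_one h0, one_div_div]
    push_cast
    ring_nf
  have hi' : Irrational (1 / ((p * y + r) / (q * y + s) + 1)) := by
    simpa using (h1.add_natCast 1).inv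
  rw [e]
  refine ⟨hi', ?_⟩
  rw [h.inv_iff hα hi', one_div_one_div, h2]
  exact (h.iff_of_eq_add_two (by ring)).symm

/-- A Euclidean algorithm: even translations and a sign bring `p` into `[0, q]`, and for `p < q` the
cusp `p / q` comes from `(q - p) / p`, of smaller denominator. The case `p = q` forces `q = 1`,
reached by `1 / 0`, `0 / 1`, `1 / 1`. -/
theorem isCuspOf_of_isCoprime (h : IsGaussInvariant α B) (hα : α ∈ Set.Icc g G) (q : ℕ) :
    ∀ p : ℤ, IsCoprime p q → IsCuspOf B p q := by
  induction q using Nat.strong_induction_on with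
  | _ q ih =>
    have base : ∀ p : ℤ, 0 ≤ p → p < q → IsCoprime p q → IsCuspOf B p q := by
      intro p h0 hlt hco
      lift p to ℕ using h0
      have hco' : IsCoprime ((q : ℤ) - p) p := by
        have := hco.symm.add_mul_left_left (-1)
        simpa [sub_eq_add_neg] using this
      have := h.isCuspOf_add hα (ih p (by exact_mod_cast hlt) _ hco')
      simpa using this
    intro p hco
    rcases Nat.eq_zero_or_pos q with rfl | hq
    · have : IsUnit p := isCoprime_zero_right.1 (by simpa using hco)
      exact h.isCuspOf_infinity hα (Int.isUnit_iff.1 this)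
    have hq' : (0 : ℤ) < q := by exact_mod_cast hq
    obtain ⟨n, p', hp, hp1, hp2⟩ : ∃ n p' : ℤ, p = p' + 2 * n * q ∧ -q < p' ∧ p' ≤ q := by
      refine ⟨-((q - p) / (2 * q)), q - (q - p) % (2 * q), ?_, ?_, ?_⟩
      · linarith [Int.emod_add_mul_ediv (q - p) (2 * q)]
      · linarith [Int.emod_lt_of_pos (q - p) (by positivity : (0 : ℤ) < 2 * q)]
      · linarith [Int.emod_nonneg (q - p) (by positivity : (2 * q : ℤ) ≠ 0)]
    have hco' : IsCoprime p' q := by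
      rw [hp, IsCoprime.add_mul_right_left_iff] at hco
      exact hco
    rw [hp]
    apply h.isCuspOf_add_mul
    rcases hp2.eq_or_lt with hpq | hpq
    · have hunit : IsUnit (q : ℤ) := by
        rw [hpq] at hco'
        exact isCoprime_self.1 hco'
      have hq1 : (q : ℤ) = 1 := by
        rcases Int.isUnit_iff.1 hunit with h' | h' <;> omega
      have h01 := h.isCuspOf_add hα (h.isCuspOf_add hα (h.isCuspOf_infinity hα (.inl rfl)))
      rw [hpq, hq1]
      exact h01
    · rcases le_or_gt 0 p' with h0 | h0
      · exact base p' h0 hpq hco'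
      · have := h.isCuspOf_neg hα (base (-p') (by omega) (by omega) hco'.neg_left)
        rwa [neg_neg] at this

/-! ### Zero-one law by Lebesgue density -/

theorem volume_compl_inter_Ioc (h : IsGaussInvariant α B) (hB : MeasurableSet B) (a b : ℝ) :
    volume (Bᶜ ∩ Ioc a (a + 2)) = volume (Bᶜ ∩ Ioc b (b + 2)) := by
  refine IsAddFundamentalDomain.measure_set_eq
    (isAddFundamentalDomain_Ioc (T := (2 : ℝ)) (by norm_num) a)
    (isAddFundamentalDomain_Ioc (T := (2 : ℝ)) (by norm_num) b) hB.compl ?_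
  rintro ⟨z, n, rfl⟩
  ext x
  have := h.add_int x n
  simp only [mem_preimage, mem_compl_iff, AddSubgroup.mk_vadd, vadd_eq_add, zsmul_eq_mul]
  rw [← this, add_comm, mul_comm]

theorem volume_compl_eq_zero (h : IsGaussInvariant α B)
    (h0 : volume (Bᶜ ∩ Ioc 0 (0 + 2)) = 0) : volume Bᶜ = 0 := by
  refine (isAddFundamentalDomain_Ioc (T := (2 : ℝ)) (by norm_num) 0).measure_zero_of_invariant
    _ ?_ h0
  rintro ⟨z, n, rfl⟩
  ext x
  have := h.add_int x (-n)
  rw [mem_vadd_set_iff_neg_vadd_mem]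
  simp only [mem_compl_iff, AddSubgroup.vadd_def, vadd_eq_add, AddSubgroup.coe_neg, zsmul_eq_mul]
  rw [← this, add_comm]
  push_cast
  ring_nf

end IsGaussInvariant

/-- There are infinitely many such approximations, while bounded denominators bound the numerators
and leave only finitely many. -/
theorem exists_rat_abs_sub_lt_of_lt_den {x : ℝ} (hx : Irrational x) (N : ℕ) :
    ∃ q : ℚ, |x - q| < 1 / (q.den : ℝ) ^ 2 ∧ N < q.den := by
  by_contra! hc
  refine Real.infinite_rat_abs_sub_lt_one_div_den_sq_of_irrational hx ?_
  obtain ⟨M, hM⟩ := exists_nat_gt (N * (|x| + 1))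
  refine ((finite_Icc (-M : ℤ) M).image2 (fun (a : ℤ) (b : ℕ) => (a : ℚ) / b)
    (finite_Iic N)).subset fun q hq => ?_
  have hN := hc q hq
  have hd : (1 : ℝ) ≤ q.den := by exact_mod_cast q.pos
  have hq1 : |x - q| < 1 := lt_of_lt_of_le hq (by rw [div_le_one (by positivity)]; nlinarith)
  have hqx : |(q : ℝ)| ≤ |x| + 1 := by
    have := abs_sub_abs_le_abs_sub (q : ℝ) x
    rw [abs_sub_comm] at this
    linarith
  have hnum : |(q.num : ℝ)| < M := by
    have e : (q.num : ℝ) = q * q.den := by exact_mod_cast (Rat.mul_den_eq_num q).symm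
    rw [e, abs_mul, abs_of_pos (by positivity : (0 : ℝ) < q.den), mul_comm]
    refine lt_of_le_of_lt ?_ hM
    have : (q.den : ℝ) ≤ N := by exact_mod_cast hN
    gcongr
  obtain ⟨h1, h2⟩ := abs_lt.1 hnum
  refine ⟨q.num, ⟨?_, ?_⟩, q.den, hN, Rat.num_div_den q⟩
  · exact_mod_cast h1.le
  · exact_mod_cast h2.le

/-- An integral Möbius transformation of determinant `±1` with pole `-s / q` maps a subset of
`(-s / q + 1, -s / q + 3]` to a set of comparable measure at scale `q⁻²`. -/
theorem le_volume_image_moebius {p q r s : ℝ} (hq : 0 < q) (hdet : (p * s - q * r) ^ 2 = 1)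
    {S : Set ℝ} (hS : MeasurableSet S) (hSJ : S ⊆ Ioc (-s / q + 1) (-s / q + 1 + 2)) :
    ENNReal.ofReal (1 / (9 * q ^ 2)) * volume S ≤
      volume ((fun y => (p * y + r) / (q * y + s)) '' S) := by
  have hb : ∀ y ∈ S, q < q * y + s ∧ q * y + s ≤ 3 * q := by
    intro y hy
    obtain ⟨h1, h2⟩ := hSJ hy
    have e : q * (-s / q) = -s := by field_simp
    constructor <;> nlinarith
  have hder : ∀ y ∈ S, HasDerivWithinAt (fun y => (p * y + r) / (q * y + s))
      ((p * s - q * r) / (q * y + s) ^ 2) S y := by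
    intro y hy
    have h0 : q * y + s ≠ 0 := by linarith [hb y hy]
    have h1 : HasDerivAt (fun y => p * y + r) p y := by
      simpa using ((hasDerivAt_id y).const_mul p).add_const r
    have h2 : HasDerivAt (fun y => q * y + s) q y := by
      simpa using ((hasDerivAt_id y).const_mul q).add_const s
    have := (h1.div h2 h0).hasDerivWithinAt (s := S)
    refine this.congr_deriv ?_
    congr 1
    ring
  have hinj : InjOn (fun y => (p * y + r) / (q * y + s)) S := by
    intro y hy z hz hyz
    have h1 : q * y + s ≠ 0 := by linarith [hb y hy]
    have h2 : q * z + s ≠ 0 := by linarith [hb z hz]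
    simp only at hyz
    rw [div_eq_div_iff h1 h2] at hyz
    have h3 : (p * s - q * r) * (y - z) = 0 := by linear_combination hyz
    rcases mul_eq_zero.1 h3 with h3 | h3
    · rw [h3] at hdet
      norm_num at hdet
    · linarith
  have := lintegral_image_eq_lintegral_abs_deriv_mul hS hder hinj 1
  simp only [Pi.one_apply, lintegral_one, mul_one, Measure.restrict_apply_univ] at this
  rw [this, ← setLIntegral_const]
  refine setLIntegral_mono' hS fun y hy => ENNReal.ofReal_le_ofReal ?_
  have habs : |p * s - q * r| = 1 := by
    rwa [← sq_eq_sq₀ (abs_nonneg _) zero_le_one, sq_abs, one_pow]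
  obtain ⟨h1, h2⟩ := hb y hy
  have h0 : 0 < q * y + s := by linarith
  rw [abs_div, habs, abs_of_pos (by positivity)]
  apply one_div_le_one_div_of_le (by positivity)
  nlinarith

/-- Gauss invariant measurable sets are null or conull for Lebesgue measure. -/
theorem IsGaussInvariant.volume_eq_zero_or {α : ℝ} {B : Set ℝ} (h : IsGaussInvariant α B)
    (hα : α ∈ Set.Icc g G) (hB : MeasurableSet B) : volume B = 0 ∨ volume Bᶜ = 0 := by
  by_contra! hcon
  obtain ⟨hB0, hBc⟩ := hcon
  have hirr : ∀ᵐ x : ℝ, Irrational x := by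
    have : volume (range ((↑) : ℚ → ℝ)) = 0 := (countable_range _).measure_zero _
    exact measure_eq_zero_iff_ae_notMem.1 this
  obtain ⟨x, hxB, hxi, hx⟩ : ∃ x ∈ B, Irrational x ∧
      Tendsto (fun r => volume (Bᶜ ∩ Metric.closedBall x r) / volume (Metric.closedBall x r))
        (𝓝[>] 0) (𝓝 0) := by
    have h1 := Besicovitch.ae_tendsto_measure_inter_div_of_measurableSet volume hB.compl
    have h2 : ∃ᵐ x, x ∈ B := frequently_ae_mem_iff.2 hB0
    obtain ⟨x, hxB, hxi, hx⟩ := (h2.and_eventually (hirr.and h1)).exists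
    refine ⟨x, hxB, hxi, ?_⟩
    simpa [indicator_of_notMem (show x ∉ Bᶜ by simpa using hxB)] using hx
  set δ := volume (Bᶜ ∩ Ioc 0 (0 + 2)) with hδ
  have hδ0 : δ ≠ 0 := fun h0 => hBc (h.volume_compl_eq_zero h0)
  -- `36 = 9 * 4`: the image will have measure at least `δ / (9 q²)`, inside a ball of length `4 /
  -- q²`.
  have hev : ∀ᶠ r in 𝓝[>] (0 : ℝ),
      volume (Bᶜ ∩ Metric.closedBall x r) / volume (Metric.closedBall x r) < δ / 36 :=
    hx.eventually_lt_const (ENNReal.div_pos hδ0 (by norm_num))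
  obtain ⟨ε, hε, hεs⟩ := mem_nhdsGT_iff_exists_Ioo_subset.1 hev
  obtain ⟨N, hN⟩ := exists_nat_gt (2 / ε)
  obtain ⟨c, hc, hcN⟩ := exists_rat_abs_sub_lt_of_lt_den hxi N
  have hd1 : (1 : ℝ) ≤ c.den := by exact_mod_cast c.pos
  have hd0 : (0 : ℝ) < c.den := by linarith
  obtain ⟨r, s, hdet, hy⟩ := h.isCuspOf_of_isCoprime hα c.den c.num
    (Int.isCoprime_iff_gcd_eq_one.2 c.reduced)
  have hdetR : ((c.num : ℝ) * s - (c.den : ℝ) * r) ^ 2 = 1 := by exact_mod_cast hdet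
  -- A full period at distance at least `1` from the pole, without the rationals, where invariance
  -- is unknown.
  set S : Set ℝ := Bᶜ ∩ Ioc (-s / (c.den : ℝ) + 1) (-s / (c.den : ℝ) + 1 + 2) ∩
    {y | Irrational y} with hS
  have hirrm : MeasurableSet {y : ℝ | Irrational y} :=
    (countable_range ((↑) : ℚ → ℝ)).measurableSet.compl
  have hSm : MeasurableSet S := (hB.compl.inter measurableSet_Ioc).inter hirrm
  have hSv : volume S = δ := by
    rw [hδ, h.volume_compl_inter_Ioc hB 0 (-s / (c.den : ℝ) + 1)]
    exact measure_inter_conull (by rwa [← mem_ae_iff])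
  have hle := le_volume_image_moebius hd0 hdetR hSm fun y hy => hy.1.2
  -- One `q⁻²` bounds the distance from the image to `c`, the other that from `c` to `x`.
  set R : ℝ := 2 / (c.den : ℝ) ^ 2 with hR
  have hsub : (fun y : ℝ => ((c.num : ℝ) * y + r) / ((c.den : ℝ) * y + s)) '' S ⊆
      Bᶜ ∩ Metric.closedBall x R := by
    rintro _ ⟨y, ⟨⟨hyB, hy1, hy2⟩, hyi⟩, rfl⟩
    refine ⟨?_, ?_⟩
    · have := (hy y hyi).2
      rw [Int.cast_natCast] at this
      rwa [mem_compl_iff, ← this]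
    · have e : (c.den : ℝ) * (-s / c.den) = -s := by field_simp
      have h0 : (c.den : ℝ) < c.den * y + s := by nlinarith
      have h0' : (0 : ℝ) < c.den * y + s := by linarith
      have habs : |(c.num : ℝ) * s - c.den * r| = 1 := by
        rwa [← sq_eq_sq₀ (abs_nonneg _) zero_le_one, sq_abs, one_pow]
      have ec : (c : ℝ) = c.num / c.den := by exact_mod_cast (Rat.num_div_den c).symm
      have h1 : |((c.num : ℝ) * y + r) / ((c.den : ℝ) * y + s) - c| ≤ 1 / (c.den : ℝ) ^ 2 := by
        have : ((c.num : ℝ) * y + r) / ((c.den : ℝ) * y + s) - c =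
            -((c.num : ℝ) * s - c.den * r) / (c.den * (c.den * y + s)) := by
          have hne : (c.den : ℝ) * y + s ≠ 0 := h0'.ne'
          rw [ec, div_sub_div _ _ hne hd0.ne', div_eq_div_iff (mul_ne_zero hne hd0.ne')
            (mul_ne_zero hd0.ne' hne)]
          ring
        rw [this, abs_div, abs_neg, habs, abs_of_pos (by positivity)]
        apply one_div_le_one_div_of_le (by positivity)
        nlinarith
      rw [Metric.mem_closedBall, Real.dist_eq]
      have h2 := abs_sub_le (((c.num : ℝ) * y + r) / ((c.den : ℝ) * y + s)) (c : ℝ) x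
      rw [abs_sub_comm (c : ℝ) x] at h2
      have e2 : R = 1 / (c.den : ℝ) ^ 2 + 1 / (c.den : ℝ) ^ 2 := by rw [hR]; ring
      linarith
  have hR0 : 0 < R := by positivity
  have hRε : R < ε := by
    have hcN' : (N : ℝ) < c.den := by exact_mod_cast hcN
    rw [hR, div_lt_iff₀ (by positivity)]
    rw [div_lt_iff₀ hε] at hN
    nlinarith
  have hlt := hεs ⟨hR0, hRε⟩
  simp only [mem_ofPred_eq] at hlt
  rw [Real.volume_closedBall, ENNReal.div_lt_iff (Or.inl (by simpa using hR0))
    (Or.inl ENNReal.ofReal_ne_top)] at hlt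
  have hfin := (hle.trans (measure_mono hsub)).trans_lt hlt
  rw [hSv, ENNReal.div_eq_inv_mul, mul_right_comm, mul_comm _ δ, mul_comm _ δ] at hfin
  refine absurd hfin (not_lt.2 ?_)
  gcongr
  rw [show (36 : ENNReal) = ENNReal.ofReal 36 by simp, ← ENNReal.ofReal_inv_of_pos (by norm_num),
    ← ENNReal.ofReal_mul (by norm_num)]
  apply ENNReal.ofReal_le_ofReal
  rw [hR]
  apply le_of_eq
  field_simp
  norm_num

end AlphaOCF
-- The marginal density and the transfer operator
namespace AlphaOCF
open MeasureTheory Set Filter Topology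

open Classical in
/-- The density of the first marginal of `μ_α`. -/
noncomputable def marginalDensity (α x : ℝ) : ℝ :=
  if x ∈ I α then
    1 / (x + G + 1) + (if (1 - α) / α < x then 1 / (x + 1) - 1 / (x + G + 1) else 0) +
      (if (α - 1) / (2 - α) ≤ x then 1 / (x + G - 1) - 1 / (x + 1) else 0)
  else 0

variable {α : ℝ}

theorem marginalDensity_of_notMem {x : ℝ} (hx : x ∉ I α) : marginalDensity α x = 0 :=
  if_neg hx

theorem pos_of_mem (hα : α ∈ Icc g G) : 0.6 < α := by
  have := hα.1
  rw [g_eq] at this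
  linarith [lt_G]

theorem lt_of_mem (hα : α ∈ Icc g G) : α < 1.7 := by
  linarith [hα.2, G_lt]

theorem add_G_add_one_pos (hα : α ∈ Icc g G) {x : ℝ} (hx : x ∈ I α) : 0 < x + G + 1 := by
  linarith [hx.1, pos_of_mem hα, lt_G]

theorem add_one_pos_of_lt (hα : α ∈ Icc g G) {x : ℝ} (hx : (1 - α) / α < x) : 0 < x + 1 := by
  have h0 := pos_of_mem hα
  rw [div_lt_iff₀ (by linarith)] at hx
  nlinarith

theorem add_one_pos_of_le (hα : α ∈ Icc g G) {x : ℝ} (hx : (α - 1) / (2 - α) ≤ x) :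
    0 < x + 1 := by
  have h0 := lt_of_mem hα
  rw [div_le_iff₀ (by linarith)] at hx
  nlinarith

theorem add_G_sub_one_pos (hα : α ∈ Icc g G) {x : ℝ} (hx : (α - 1) / (2 - α) ≤ x) :
    0 < x + G - 1 := by
  have h0 := lt_of_mem hα
  rw [div_le_iff₀ (by linarith)] at hx
  have h1 := hα.1
  rw [g_eq] at h1
  nlinarith [lt_G, G_lt, G_sq]

theorem marginalDensity_nonneg (hα : α ∈ Icc g G) (x : ℝ) : 0 ≤ marginalDensity α x := by
  unfold marginalDensity
  split_ifs with hI h1 h2 h2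
  all_goals try have p1 := add_G_add_one_pos hα hI
  · have p2 := add_G_sub_one_pos hα h2
    have : 0 ≤ 1 / (x + G - 1) := by positivity
    linarith
  · have p2 := add_one_pos_of_lt hα h1
    have : 0 ≤ 1 / (x + 1) := by positivity
    linarith
  · have p2 := add_G_sub_one_pos hα h2
    have p3 := add_one_pos_of_le hα h2
    have : 1 / (x + 1) ≤ 1 / (x + G - 1) :=
      one_div_le_one_div_of_le p2 (by linarith [G_lt])
    have : 0 ≤ 1 / (x + G + 1) := by positivity
    linarith
  · simp only [add_zero]
    positivity
  · exact le_rfl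

theorem measurable_marginalDensity (α : ℝ) : Measurable (marginalDensity α) := by
  unfold marginalDensity
  refine Measurable.ite (show MeasurableSet (I α) from measurableSet_Ico) ?_ measurable_const
  refine Measurable.add (Measurable.add (by fun_prop) ?_) ?_
  · exact Measurable.ite measurableSet_Ioi (by fun_prop) measurable_const
  · exact Measurable.ite measurableSet_Ici (by fun_prop) measurable_const

/-- Contribution to the transfer operator of the branch `x = 1 / D`. -/
theorem marginalDensity_one_div (hα : α ∈ Icc g G) {D : ℝ} (hD : 0 < D) (hDα : 1 < α * D) :
    marginalDensity α (1 / D) / D ^ 2 =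
      (1 / D - 1 / (D + 2 - G)) +
      (if D * (1 - α) < α then 1 / (D + 2 - G) - 1 / (D + 1) else 0) +
      (if D * (α - 1) ≤ 2 - α then 1 / (D + 1) - 1 / (D + G) else 0) := by
  have h0 := pos_of_mem hα
  have h1 := lt_of_mem hα
  have hG := lt_G
  have hG' := G_lt
  have hmem : 1 / D ∈ I α := by
    constructor
    · have : 0 < 1 / D := by positivity
      linarith
    · rwa [div_lt_iff₀ hD]
  have c1 : (1 - α) / α < 1 / D ↔ D * (1 - α) < α := by
    rw [div_lt_div_iff₀ (by linarith) hD, one_mul, mul_comm]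
  have c2 : (α - 1) / (2 - α) ≤ 1 / D ↔ D * (α - 1) ≤ 2 - α := by
    rw [div_le_div_iff₀ (by linarith) hD, one_mul, mul_comm]
  have n1 : D + 2 - G ≠ 0 := by linarith
  have n2 : D + 1 ≠ 0 := by linarith
  have n3 : D + G ≠ 0 := by linarith
  -- Partial fractions; the poles are explicit because `(G + 1) (2 - G) = 1` and `G (G - 1) = 1`.
  have e0 : (1 / (1 / D + G + 1)) / D ^ 2 = 1 / D - 1 / (D + 2 - G) := by
    have m : 1 / D + G + 1 = (1 + (G + 1) * D) / D := by field_simp; ring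
    have m' : 1 + (G + 1) * D ≠ 0 := by positivity
    rw [m]
    field_simp
    linear_combination D * G_sq
  have e1 : (1 / (1 / D + 1)) / D ^ 2 = 1 / D - 1 / (D + 1) := by
    have m : 1 / D + 1 = (D + 1) / D := by field_simp; ring
    rw [m]
    field_simp
    ring
  have e2 : (1 / (1 / D + G - 1)) / D ^ 2 = 1 / D - 1 / (D + G) := by
    have m : 1 / D + G - 1 = (1 + (G - 1) * D) / D := by field_simp; ring
    have m' : 1 + (G - 1) * D ≠ 0 := by nlinarith
    rw [m]
    field_simp
    linear_combination -D * G_sq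
  rw [marginalDensity, if_pos hmem, add_div, add_div, e0]
  simp only [c1, c2]
  simp only [apply_ite (· / D ^ 2), zero_div, sub_div, e0, e1, e2]
  congr 1
  · congr 1
    split_ifs <;> ring
  · split_ifs <;> ring

/-- Contribution to the transfer operator of the branch `x = -1 / E`. -/
theorem marginalDensity_neg_one_div (hα : α ∈ Icc g G) {E : ℝ} (hE : 0 < E)
    (hEα : 1 ≤ (2 - α) * E) :
    marginalDensity α (-1 / E) / E ^ 2 =
      (1 / (E - 2 + G) - 1 / E) +
      (if α < E * (α - 1) then 1 / (E - 1) - 1 / (E - 2 + G) else 0) +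
      (if 2 - α ≤ E * (1 - α) then 1 / (E - G) - 1 / (E - 1) else 0) := by
  have h0 := pos_of_mem hα
  have h1 := lt_of_mem hα
  have hG := lt_G
  have hG' := G_lt
  have hgα := hα.1
  rw [g_eq] at hgα
  have hmem : -1 / E ∈ I α := by
    constructor
    · rw [le_div_iff₀ hE]
      linarith
    · have : -1 / E < 0 := div_neg_of_neg_of_pos (by norm_num) hE
      linarith
  have c1 : (1 - α) / α < -1 / E ↔ α < E * (α - 1) := by
    rw [div_lt_div_iff₀ (by linarith) hE]
    constructor <;> intro <;> linarith
  have c2 : (α - 1) / (2 - α) ≤ -1 / E ↔ 2 - α ≤ E * (1 - α) := by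
    rw [div_le_div_iff₀ (by linarith) hE]
    constructor <;> intro <;> linarith
  have n0 : 0 < E - 2 + G := by nlinarith
  have e0 : (1 / (-1 / E + G + 1)) / E ^ 2 = 1 / (E - 2 + G) - 1 / E := by
    have m : -1 / E + G + 1 = ((G + 1) * (E - 2 + G)) / E := by
      field_simp
      linear_combination -G_sq
    have m' : G + 1 ≠ 0 := by linarith
    rw [m]
    field_simp
    linear_combination G_sq
  have e1 : E - 1 ≠ 0 → (1 / (-1 / E + 1)) / E ^ 2 = 1 / (E - 1) - 1 / E := by
    intro hne
    have m : -1 / E + 1 = (E - 1) / E := by field_simp; ring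
    rw [m]
    field_simp
    ring
  have e2 : E - G ≠ 0 → (1 / (-1 / E + G - 1)) / E ^ 2 = 1 / (E - G) - 1 / E := by
    intro hne
    have m : -1 / E + G - 1 = ((G - 1) * (E - G)) / E := by
      field_simp
      linear_combination G_sq
    have m' : G - 1 ≠ 0 := by linarith
    rw [m]
    field_simp
    linear_combination -G_sq
  rw [marginalDensity, if_pos hmem, add_div, add_div, e0]
  simp only [c1, c2]
  simp only [apply_ite (· / E ^ 2), zero_div, sub_div, e0]
  congr 1
  · congr 1
    split_ifs with hc
    · rw [e1]
      · ring
      · intro hne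
        have : E = 1 := by linarith
        subst this
        linarith
    · rfl
  · split_ifs with hc
    · have hα1 : α < 1 := by
        by_contra hα1
        nlinarith
      have : G < E := by nlinarith
      rw [e1 (by linarith), e2 (by linarith)]
      ring
    · rfl

/-- The branches `x = 1 / D` and `x = -1 / (D + 2)` together contribute `1 / D - 1 / (D + 2)`. -/
theorem marginalDensity_pair (hα : α ∈ Icc g G) {D : ℝ} (hD : 0 < D) (hDα : 1 < α * D)
    (hEα : 1 ≤ (2 - α) * (D + 2)) :
    marginalDensity α (1 / D) / D ^ 2 + marginalDensity α (-1 / (D + 2)) / (D + 2) ^ 2 =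
      1 / D - 1 / (D + 2) := by
  rw [marginalDensity_one_div hα hD hDα, marginalDensity_neg_one_div hα (by linarith) hEα]
  -- The second rectangle over one branch and the third over the other contribute the same
  -- difference under complementary conditions, so exactly one of them is present.
  have c1 : α < (D + 2) * (α - 1) ↔ ¬ (D * (α - 1) ≤ 2 - α) := by
    rw [not_le]
    constructor <;> intro <;> linarith
  have c2 : 2 - α ≤ (D + 2) * (1 - α) ↔ ¬ (D * (1 - α) < α) := by
    rw [not_lt]
    constructor <;> intro <;> linarith
  have e1 : D + 2 - 2 + G = D + G := by ring
  have e2 : D + 2 - 1 = D + 1 := by ring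
  simp only [c1, c2, e1, e2]
  split_ifs <;> ring

/-- The summand of the transfer operator for the branch `x = ε / (c + y)`. -/
noncomputable def transferTerm (α ε c y : ℝ) : ℝ :=
  if 0 < c + y then marginalDensity α (ε / (c + y)) / (c + y) ^ 2 else 0

theorem transferTerm_nonneg (hα : α ∈ Icc g G) (ε c y : ℝ) : 0 ≤ transferTerm α ε c y := by
  unfold transferTerm
  split_ifs
  · have := marginalDensity_nonneg hα (ε / (c + y))
    positivity
  · exact le_rfl

/-- For `c ≥ 3` both preimages lie in `I α`: `c + y > α + 1` and `α (α + 1) ≥ 1`. -/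
theorem transferTerm_pair (hα : α ∈ Icc g G) {y c : ℝ} (hy : y ∈ Ioo (α - 2) α) (hc : 3 ≤ c) :
    transferTerm α 1 c y + transferTerm α (-1) (c + 2) y = 1 / (c + y) - 1 / (c + 2 + y) := by
  have h0 := pos_of_mem hα
  have h1 := lt_of_mem hα
  have hsq := sq_le_of_mem hα
  have hsq' := one_le_of_mem hα
  obtain ⟨hy1, hy2⟩ := hy
  have e : c + 2 + y = c + y + 2 := by ring
  rw [transferTerm, transferTerm, e, if_pos (by linarith), if_pos (by linarith)]
  exact marginalDensity_pair hα (by linarith) (by nlinarith) (by nlinarith)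

/-- The point `1 / (1 + y)` lies below `α` only if `y > (1 - α) / α`. Otherwise just the branch `-1
/ (3 + y)` survives, with only the first rectangle over it. -/
theorem transferTerm_first (hα : α ∈ Icc g G) {y : ℝ} (hy : y ∈ Ioo (α - 2) α) :
    transferTerm α 1 1 y + transferTerm α (-1) (1 + 2) y =
      1 / (y + G + 1) - 1 / (3 + y) +
        if (1 - α) / α < y then 1 / (y + 1) - 1 / (y + G + 1) else 0 := by
  have h0 := pos_of_mem hα
  have h1 := lt_of_mem hα
  have hsq := sq_le_of_mem hα
  have hsq' := one_le_of_mem hα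
  obtain ⟨hy1, hy2⟩ := hy
  have e : 1 + 2 + y = 1 + y + 2 := by ring
  have e' : 1 + y + 2 = 3 + y := by ring
  split_ifs with hc
  · have hpos := add_one_pos_of_lt hα hc
    rw [div_lt_iff₀ (by linarith)] at hc
    rw [transferTerm, transferTerm, e, if_pos (by linarith), if_pos (by linarith),
      marginalDensity_pair hα (by linarith) (by nlinarith) (by nlinarith)]
    ring_nf
  · rw [not_lt, le_div_iff₀ (by linarith)] at hc
    have hz : transferTerm α 1 1 y = 0 := by
      unfold transferTerm
      split_ifs with hp
      · rw [marginalDensity_of_notMem, zero_div]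
        intro hm
        have := hm.2
        rw [div_lt_iff₀ hp] at this
        linarith
      · rfl
    rw [hz, transferTerm, e, e', if_pos (by linarith),
      marginalDensity_neg_one_div hα (by linarith) (by nlinarith), if_neg, if_neg]
    · ring_nf
    · rw [not_le]
      rcases le_or_gt 1 α with h' | h'
      · nlinarith
      · nlinarith
    · rw [not_lt]
      rcases le_or_gt α 1 with h' | h'
      · nlinarith
      · have : α * ((3 + y) * (α - 1)) ≤ α * α := by nlinarith
        exact le_of_mul_le_mul_left this (by linarith)

theorem transferTerm_neg_one (hα : α ∈ Icc g G) {y : ℝ} (hy : y ∈ Ioo (α - 2) α) :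
    transferTerm α (-1) 1 y =
      if (α - 1) / (2 - α) ≤ y then 1 / (y + G - 1) - 1 / (y + 1) else 0 := by
  have h0 := pos_of_mem hα
  have h1 := lt_of_mem hα
  have hsq := sq_le_of_mem hα
  obtain ⟨hy1, hy2⟩ := hy
  split_ifs with hc
  · have hpos := add_one_pos_of_le hα hc
    rw [div_le_iff₀ (by linarith)] at hc
    rw [transferTerm, if_pos (by linarith),
      marginalDensity_neg_one_div hα (by linarith) (by nlinarith), if_neg, if_neg]
    · ring_nf
    · rw [not_le]
      rcases le_or_gt 1 α with h' | h'
      · nlinarith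
      · nlinarith
    · rw [not_lt]
      rcases le_or_gt α 1 with h' | h'
      · nlinarith
      · nlinarith
  · rw [not_le, lt_div_iff₀ (by linarith)] at hc
    unfold transferTerm
    split_ifs with hp
    · rw [marginalDensity_of_notMem, zero_div]
      intro hm
      have := hm.1
      rw [le_div_iff₀ hp] at this
      linarith
    · rfl

theorem hasSum_telescope {c : ℝ} (hc : 0 < c) :
    HasSum (fun n : ℕ => 1 / (2 * n + c) - 1 / (2 * n + 2 + c)) (1 / c) := by
  rw [hasSum_iff_tendsto_nat_of_nonneg]
  · have h : ∀ N : ℕ, ∑ n ∈ Finset.range N, (1 / (2 * (n : ℝ) + c) - 1 / (2 * n + 2 + c)) =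
        1 / c - 1 / (2 * N + c) := by
      intro N
      have := Finset.sum_range_sub' (fun n : ℕ => 1 / (2 * (n : ℝ) + c)) N
      simp only [Nat.cast_zero, mul_zero, zero_add] at this
      rw [← this]
      refine Finset.sum_congr rfl fun n _ => ?_
      push_cast
      ring_nf
    simp only [h]
    have h2 : Tendsto (fun N : ℕ => 2 * (N : ℝ) + c) atTop atTop :=
      tendsto_atTop_add_const_right _ _
        (tendsto_natCast_atTop_atTop.const_mul_atTop (by norm_num))
    simpa using (tendsto_const_nhds (x := 1 / c)).sub (h2.const_div_atTop 1)
  · intro n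
    rw [sub_nonneg]
    exact one_div_le_one_div_of_le (by positivity) (by linarith)

/-- The marginal density is a fixed point of the transfer operator. -/
theorem tsum_transferTerm (hα : α ∈ Icc g G) {y : ℝ} (hy : y ∈ Ioo (α - 2) α) :
    ∑' n : ℕ, ENNReal.ofReal (transferTerm α 1 (2 * n + 1) y) +
      ∑' n : ℕ, ENNReal.ofReal (transferTerm α (-1) (2 * n + 1) y) =
      ENNReal.ofReal (marginalDensity α y) := by
  have h0 := pos_of_mem hα
  have hI : y ∈ I α := ⟨hy.1.le, hy.2⟩
  -- Splitting off `-1 / (1 + y)` shifts the negative branches, so that digit `2 n + 1` is paired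
  -- with `2 n + 3`.
  rw [tsum_eq_zero_add' (f := fun n : ℕ => ENNReal.ofReal (transferTerm α (-1) (2 * n + 1) y))
    ENNReal.summable, add_left_comm, ← ENNReal.tsum_add]
  have hpair : ∀ n : ℕ, ENNReal.ofReal (transferTerm α 1 (2 * n + 1) y) +
      ENNReal.ofReal (transferTerm α (-1) (2 * (n + 1 : ℕ) + 1) y) =
      ENNReal.ofReal (transferTerm α 1 (2 * n + 1) y +
        transferTerm α (-1) (2 * n + 1 + 2) y) := by
    intro n
    rw [ENNReal.ofReal_add (transferTerm_nonneg hα _ _ _) (transferTerm_nonneg hα _ _ _)]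
    congr 3
    push_cast
    ring
  simp only [hpair]
  rw [tsum_eq_zero_add' ENNReal.summable]
  have htail : ∑' n : ℕ, ENNReal.ofReal (transferTerm α 1 (2 * (n + 1 : ℕ) + 1) y +
      transferTerm α (-1) (2 * (n + 1 : ℕ) + 1 + 2) y) = ENNReal.ofReal (1 / (3 + y)) := by
    have hs := hasSum_telescope (c := 3 + y) (by linarith [hy.1])
    rw [← hs.tsum_eq, ENNReal.ofReal_tsum_of_nonneg _ hs.summable]
    · refine tsum_congr fun n => ?_
      have hn : (0 : ℝ) ≤ n := n.cast_nonneg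
      rw [transferTerm_pair hα hy (by push_cast; linarith)]
      push_cast
      ring_nf
    · intro n
      rw [sub_nonneg]
      exact one_div_le_one_div_of_le (by linarith [hy.1, (n.cast_nonneg : (0 : ℝ) ≤ n)])
        (by linarith)
  rw [htail]
  simp only [Nat.cast_zero, mul_zero, zero_add]
  rw [← ENNReal.ofReal_add (add_nonneg (transferTerm_nonneg hα _ _ _)
      (transferTerm_nonneg hα _ _ _)) (one_div_nonneg.2 (by linarith [hy.1])),
    ← ENNReal.ofReal_add (transferTerm_nonneg hα _ _ _) (add_nonneg
      (add_nonneg (transferTerm_nonneg hα _ _ _) (transferTerm_nonneg hα _ _ _))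
      (one_div_nonneg.2 (by linarith [hy.1])))]
  congr 1
  rw [transferTerm_first hα hy, transferTerm_neg_one hα hy, marginalDensity, if_pos hI]
  ring

end AlphaOCF
-- Inverse branches and invariance of the marginal measure
namespace AlphaOCF
open MeasureTheory Set Filter Topology

variable {α : ℝ}

theorem measurable_gaussFun (α : ℝ) : Measurable (gaussFun α) := by
  unfold gaussFun digit
  refine Measurable.ite (measurableSet_singleton 0) measurable_const ?_
  have h1 : Measurable fun x : ℝ => 1 / (2 * |x|) + (1 - α) / 2 := by fun_prop
  have h2 : Measurable fun n : ℤ => ((2 * n + 1 : ℤ) : ℝ) := measurable_from_top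
  have h3 : Measurable fun x : ℝ => 1 / |x| := by fun_prop
  exact h3.sub (h2.comp (Int.measurable_floor.comp h1))

theorem gaussFun_eq {x y : ℝ} (hx : x ≠ 0) (hy : y ∈ I α) {n : ℤ}
    (h : 1 / |x| = 2 * n + 1 + y) : gaussFun α x = y := by
  have hf : ⌊1 / (2 * |x|) + (1 - α) / 2⌋ = n := by
    rw [Int.floor_eq_iff]
    have e : 1 / (2 * |x|) = 1 / |x| / 2 := by field_simp
    rw [e, h]
    constructor <;> linarith [hy.1, hy.2]
  rw [gaussFun, if_neg hx, digit, hf, h]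
  push_cast
  ring

/-- The absolutely continuous measure with the marginal density. -/
noncomputable def marginal (α : ℝ) : Measure ℝ :=
  volume.withDensity fun x => ENNReal.ofReal (marginalDensity α x)

/-- The part of `E` on which the inverse branches with digit `c` are defined. -/
def branchDomain (α c : ℝ) (E : Set ℝ) : Set ℝ := (E ∩ I α) ∩ {y | 0 < c + y}

theorem measurableSet_branchDomain (c : ℝ) {E : Set ℝ} (hE : MeasurableSet E) :
    MeasurableSet (branchDomain α c E) :=
  (hE.inter measurableSet_Ico).inter (measurableSet_lt measurable_const (by fun_prop))

theorem hasDerivAt_branch {ε c y : ℝ} (hy : 0 < c + y) :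
    HasDerivAt (fun y => ε / (c + y)) (-ε / (c + y) ^ 2) y := by
  have h1 : HasDerivAt (fun y => c + y) 1 y := (hasDerivAt_id y).const_add c
  refine ((hasDerivAt_const y ε).div h1 hy.ne').congr_deriv ?_
  congr 1
  ring

theorem injOn_branch {ε c : ℝ} (hε : ε ≠ 0) (E : Set ℝ) :
    InjOn (fun y => ε / (c + y)) (branchDomain α c E) := by
  rintro y ⟨_, hy⟩ z ⟨_, hz⟩ h
  simp only [mem_ofPred_eq] at hy hz h
  rw [div_eq_div_iff hy.ne' hz.ne'] at h
  have := mul_left_cancel₀ hε h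
  linarith

/-- Change of variables `x = ε / (c + y)`, whose Jacobian is the weight in `transferTerm`. -/
theorem lintegral_branch {ε : ℝ} (hε : |ε| = 1) (c : ℝ) {E : Set ℝ}
    (hE : MeasurableSet E) :
    ∫⁻ x in (fun y => ε / (c + y)) '' branchDomain α c E, ENNReal.ofReal (marginalDensity α x) =
      ∫⁻ y in E ∩ I α, ENNReal.ofReal (transferTerm α ε c y) := by
  have hε0 : ε ≠ 0 := by
    intro h
    simp [h] at hε
  have hm : MeasurableSet {y : ℝ | 0 < c + y} := measurableSet_lt measurable_const (by fun_prop)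
  rw [lintegral_image_eq_lintegral_abs_deriv_mul (measurableSet_branchDomain c hE)
    (fun y hy => (hasDerivAt_branch hy.2).hasDerivWithinAt) (injOn_branch hε0 E)]
  rw [branchDomain, inter_comm, ← setLIntegral_indicator hm]
  refine lintegral_congr fun y => ?_
  by_cases hy : 0 < c + y
  · rw [indicator_of_mem (show y ∈ {y : ℝ | 0 < c + y} from hy), transferTerm, if_pos hy,
      ← ENNReal.ofReal_mul (abs_nonneg _), abs_div, abs_neg, hε, abs_of_pos (by positivity)]
    congr 1
    ring
  · rw [indicator_of_notMem (show y ∉ {y : ℝ | 0 < c + y} from hy), transferTerm, if_neg hy,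
      ENNReal.ofReal_zero]

/-- The union of the images of `E` under the inverse branches of sign `ε`. -/
def branchImage (α ε : ℝ) (E : Set ℝ) : Set ℝ :=
  ⋃ n : ℕ, (fun y => ε / ((2 * n + 1 : ℝ) + y)) '' branchDomain α (2 * n + 1) E

theorem measurableSet_branch {ε : ℝ} (hε : ε ≠ 0) (c : ℝ) {E : Set ℝ} (hE : MeasurableSet E) :
    MeasurableSet ((fun y => ε / (c + y)) '' branchDomain α c E) :=
  (measurableSet_branchDomain c hE).image_of_continuousOn_injOn
    (fun _ hy => (hasDerivAt_branch hy.2).continuousAt.continuousWithinAt) (injOn_branch hε E)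

theorem lintegral_branchImage {ε : ℝ} (hε : |ε| = 1) {E : Set ℝ}
    (hE : MeasurableSet E) :
    ∫⁻ x in branchImage α ε E, ENNReal.ofReal (marginalDensity α x) =
      ∑' n : ℕ, ∫⁻ y in E ∩ I α, ENNReal.ofReal (transferTerm α ε (2 * n + 1) y) := by
  have hε0 : ε ≠ 0 := by
    intro h
    simp [h] at hε
  rw [branchImage, lintegral_iUnion (fun n => measurableSet_branch hε0 _ hE)]
  · exact tsum_congr fun n => lintegral_branch hε _ hE
  · intro n m hnm
    rw [Function.onFun, Set.disjoint_left]
    rintro _ ⟨y, ⟨⟨_, hy⟩, hy0⟩, rfl⟩ ⟨z, ⟨⟨_, hz⟩, hz0⟩, hyz⟩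
    simp only [mem_ofPred_eq] at hy0 hz0 hyz
    rw [div_eq_div_iff hz0.ne' hy0.ne'] at hyz
    have h := mul_left_cancel₀ hε0 hyz
    have h1 : (n : ℝ) < m + 1 := by linarith [hy.1, hz.2]
    have h2 : (m : ℝ) < n + 1 := by linarith [hy.2, hz.1]
    norm_cast at h1 h2
    omega

theorem mem_preimage_gaussFun_iff (hα : α ∈ Icc g G) {x : ℝ} (hx : x ∈ I α) (hx0 : x ≠ 0)
    (E : Set ℝ) : gaussFun α x ∈ E ↔ x ∈ branchImage α 1 E ∪ branchImage α (-1) E := by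
  have h0 := pos_of_mem hα
  have h1 := lt_of_mem hα
  have hpos : 0 < |x| := abs_pos.2 hx0
  -- This makes the digit at least `1`, so natural numbers index all branches; for `α > 1` it rests
  -- on `α ^ 2 ≤ α + 1`.
  have hxb : (α - 1) * |x| ≤ 1 := by
    rcases le_or_gt α 1 with h | h
    · nlinarith
    · have : |x| ≤ α := abs_le.2 ⟨by linarith [hx.1], hx.2.le⟩
      nlinarith [sq_le_of_mem hα]
  constructor
  · intro hE
    set n := ⌊1 / (2 * |x|) + (1 - α) / 2⌋ with hn
    have hφ : gaussFun α x = 1 / |x| - (2 * n + 1) := by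
      rw [gaussFun, if_neg hx0, digit]
      push_cast
      ring
    have hn0 : 0 ≤ n := by
      have e : 1 / (2 * |x|) = 1 / |x| / 2 := by field_simp
      have : α - 1 ≤ 1 / |x| := by rwa [le_div_iff₀ hpos]
      rw [hn, Int.floor_nonneg, e]
      linarith
    clear_value n
    lift n to ℕ using hn0
    have hy : 1 / |x| = 2 * (n : ℝ) + 1 + gaussFun α x := by
      rw [hφ]
      push_cast
      ring
    have hmem : gaussFun α x ∈ branchDomain α (2 * (n : ℝ) + 1) E := by
      refine ⟨⟨hE, gaussFun_mem hα x⟩, ?_⟩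
      rw [mem_ofPred_eq, ← hy]
      positivity
    rcases lt_or_gt_of_ne hx0 with h | h
    · refine Or.inr (mem_iUnion.2 ⟨n, _, hmem, ?_⟩)
      simp only
      rw [← hy, abs_of_neg h]
      field_simp
    · refine Or.inl (mem_iUnion.2 ⟨n, _, hmem, ?_⟩)
      simp only
      rw [← hy, abs_of_pos h]
      field_simp
  · have key : ∀ ε : ℝ, |ε| = 1 → x ∈ branchImage α ε E → gaussFun α x ∈ E := by
      intro ε hε hxε
      obtain ⟨n, y, ⟨⟨hyE, hyI⟩, hy0⟩, rfl⟩ := mem_iUnion.1 hxε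
      rw [mem_ofPred_eq] at hy0
      rwa [gaussFun_eq hx0 hyI (n := n)]
      simp only [abs_div, hε, abs_of_pos hy0, one_div_one_div, Int.cast_natCast]
    rintro (h | h)
    · exact key 1 (by simp) h
    · exact key (-1) (by simp) h

/-- The marginal measure is invariant under the Gauss map. -/
theorem marginal_preimage_gaussFun (hα : α ∈ Icc g G) {E : Set ℝ} (hE : MeasurableSet E) :
    marginal α (gaussFun α ⁻¹' E) = marginal α E := by
  set k : ℝ → ENNReal := fun x => ENNReal.ofReal (marginalDensity α x) with hk
  have hkI : ∀ x ∉ I α, k x = 0 := fun x hx => by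
    rw [hk]
    simp only
    rw [marginalDensity_of_notMem hx, ENNReal.ofReal_zero]
  have hm1 : ∀ ε : ℝ, ε ≠ 0 → MeasurableSet (branchImage α ε E) := fun ε hε =>
    MeasurableSet.iUnion fun n => measurableSet_branch hε _ hE
  have hpre := measurable_gaussFun α hE
  have h0 : ∀ᵐ x : ℝ, x ≠ 0 := by simp [ae_iff]
  have hl : ∀ᵐ y : ℝ, y ≠ α - 2 := by simp [ae_iff]
  have htm : ∀ (ε c : ℝ), Measurable fun y => ENNReal.ofReal (transferTerm α ε c y) := by
    intro ε c
    unfold transferTerm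
    refine (Measurable.ite (measurableSet_lt measurable_const (by fun_prop)) ?_
      measurable_const).ennreal_ofReal
    exact ((measurable_marginalDensity α).comp (by fun_prop)).div (by fun_prop)
  have step1 : ∫⁻ x in gaussFun α ⁻¹' E, k x =
      ∫⁻ x in branchImage α 1 E ∪ branchImage α (-1) E, k x := by
    rw [← lintegral_indicator hpre,
      ← lintegral_indicator ((hm1 1 (by norm_num)).union (hm1 (-1) (by norm_num)))]
    refine lintegral_congr_ae ?_
    filter_upwards [h0] with x hx0
    by_cases hx : x ∈ I α
    · have := mem_preimage_gaussFun_iff hα hx hx0 E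
      by_cases h : gaussFun α x ∈ E
      · rw [indicator_of_mem (show x ∈ gaussFun α ⁻¹' E from h), indicator_of_mem (this.1 h)]
      · rw [indicator_of_notMem (show x ∉ gaussFun α ⁻¹' E from h),
          indicator_of_notMem fun h' => h (this.2 h')]
    · classical
      rw [indicator_apply, indicator_apply, hkI x hx, ite_self, ite_self]
  have hdisj : Disjoint (branchImage α 1 E) (branchImage α (-1) E) := by
    rw [Set.disjoint_left]
    intro x h1 h2
    obtain ⟨n, y, ⟨_, hy0⟩, rfl⟩ := mem_iUnion.1 h1
    obtain ⟨m, z, ⟨_, hz0⟩, hyz⟩ := mem_iUnion.1 h2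
    simp only [mem_ofPred_eq] at hy0 hz0 hyz
    have p1 : 0 < 1 / (2 * (n : ℝ) + 1 + y) := by positivity
    have p2 : -1 / (2 * (m : ℝ) + 1 + z) < 0 := div_neg_of_neg_of_pos (by norm_num) hz0
    linarith
  rw [marginal, withDensity_apply _ hpre, withDensity_apply _ hE, step1,
    lintegral_union (hm1 (-1) (by norm_num)) hdisj,
    lintegral_branchImage (by simp) hE, lintegral_branchImage (by simp) hE,
    ← lintegral_tsum fun n => (htm _ _).aemeasurable,
    ← lintegral_tsum fun n => (htm _ _).aemeasurable,
    ← lintegral_add_left (Measurable.tsum fun n => htm _ _)]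
  have step2 : ∫⁻ y in E ∩ I α, (∑' n : ℕ, ENNReal.ofReal (transferTerm α 1 (2 * n + 1) y) +
      ∑' n : ℕ, ENNReal.ofReal (transferTerm α (-1) (2 * n + 1) y)) = ∫⁻ y in E ∩ I α, k y := by
    refine setLIntegral_congr_fun_ae (hE.inter measurableSet_Ico) ?_
    filter_upwards [hl] with y hy hyE
    exact tsum_transferTerm hα ⟨lt_of_le_of_ne hyE.2.1 hy.symm, hyE.2.2⟩
  rw [step2, inter_comm, ← setLIntegral_indicator (show MeasurableSet (I α) from measurableSet_Ico)]
  refine lintegral_congr fun x => ?_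
  by_cases hx : x ∈ I α
  · exact indicator_of_mem hx k
  · rw [indicator_of_notMem hx k]
    exact (hkI x hx).symm

end AlphaOCF
-- Fibre integrals and total mass
namespace AlphaOCF
open MeasureTheory Set Filter Topology

variable {α : ℝ}

theorem lintegral_Ioc_of_hasDerivAt {F f : ℝ → ℝ} {a b : ℝ} (hab : a ≤ b)
    (hF : ∀ y ∈ Icc a b, HasDerivAt F (f y) y) (hf : ∀ y ∈ Icc a b, 0 ≤ f y) :
    ∫⁻ y in Ioc a b, ENNReal.ofReal (f y) = ENNReal.ofReal (F b - F a) := by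
  have hc : ContinuousOn F (Icc a b) := fun y hy => (hF y hy).continuousAt.continuousWithinAt
  have hi : IntegrableOn f (Ioc a b) := intervalIntegral.integrableOn_deriv_of_nonneg hc
    (fun y hy => hF y (Ioo_subset_Icc_self hy)) (fun y hy => hf y (Ioo_subset_Icc_self hy))
  have hpos : 0 ≤ᵐ[volume.restrict (Ioc a b)] f :=
    (ae_restrict_iff' measurableSet_Ioc).2 (.of_forall fun y hy => hf y (Ioc_subset_Icc_self hy))
  rw [← ofReal_integral_eq_lintegral_ofReal hi hpos, ← intervalIntegral.integral_of_le hab,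
    intervalIntegral.integral_eq_sub_of_hasDerivAt (fun y hy => hF y (by rwa [uIcc_of_le hab] at hy))
      ((intervalIntegrable_iff_integrableOn_Ioc_of_le hab).2 hi)]

theorem lintegral_fiber_Ioc {x a b : ℝ} (hab : a ≤ b) (ha : 0 < 1 + x * a) (hb : 0 < 1 + x * b) :
    ∫⁻ y in Ioc a b, ENNReal.ofReal (1 / (1 + x * y) ^ 2) =
      ENNReal.ofReal (b / (1 + x * b) - a / (1 + x * a)) := by
  refine lintegral_Ioc_of_hasDerivAt (F := fun y => y / (1 + x * y)) hab (fun y hy => ?_)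
    fun y _ => by positivity
  have hpos : 0 < 1 + x * y := by
    rcases le_or_gt 0 x with h | h
    · nlinarith [hy.1]
    · nlinarith [hy.2]
  have h1 : HasDerivAt (fun y => 1 + x * y) x y := by
    simpa using ((hasDerivAt_id y).const_mul x).const_add 1
  refine ((hasDerivAt_id y).div h1 hpos.ne').congr_deriv ?_
  simp only [id]
  congr 1
  ring

theorem sub_two_le_image_right (hα : α ∈ Icc g G) : α - 2 ≤ (1 - α) / α := by
  rw [le_div_iff₀ (by linarith [pos_of_mem hα])]
  linarith [sq_le_of_mem hα]

theorem sub_two_le_image_left (hα : α ∈ Icc g G) : α - 2 ≤ (α - 1) / (2 - α) := by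
  rw [le_div_iff₀ (by linarith [lt_of_mem hα])]
  nlinarith [sq_nonneg (α - 3 / 2)]

theorem Omega_fiber (hα : α ∈ Icc g G) (x : ℝ) :
    {y | (x, y) ∈ Omega α} = {y | x ∈ I α ∧ y ∈ Ico 0 (2 - G)} ∪
      {y | (x ∈ I α ∧ (1 - α) / α < x) ∧ y ∈ Ioc (2 - G) 1} ∪
      {y | (x ∈ I α ∧ (α - 1) / (2 - α) ≤ x) ∧ y ∈ Ico 1 G} := by
  have a1 := sub_two_le_image_right hα
  have a2 := sub_two_le_image_left hα
  ext y
  simp only [Omega, I, mem_union, mem_prod, mem_ofPred_eq, mem_Ico, mem_Ioo, mem_Ioc]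
  constructor
  · rintro ((h | h) | h)
    · exact Or.inl (Or.inl h)
    · exact Or.inl (Or.inr ⟨⟨⟨by linarith [h.1.1], h.1.2⟩, h.1.1⟩, h.2⟩)
    · exact Or.inr ⟨⟨⟨by linarith [h.1.1], h.1.2⟩, h.1.1⟩, h.2⟩
  · rintro ((h | h) | h)
    · exact Or.inl (Or.inl h)
    · exact Or.inl (Or.inr ⟨⟨h.1.2, h.1.1.2⟩, h.2⟩)
    · exact Or.inr ⟨⟨h.1.2, h.1.1.2⟩, h.2⟩

theorem setLIntegral_and {P : Prop} [Decidable P] (s : Set ℝ) (f : ℝ → ENNReal) :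
    ∫⁻ y in {y | P ∧ y ∈ s}, f y = if P then ∫⁻ y in s, f y else 0 := by
  split_ifs with h <;> simp [h]

theorem measurableSet_and {P : Prop} {s : Set ℝ} (hs : MeasurableSet s) :
    MeasurableSet {y | P ∧ y ∈ s} := by
  by_cases h : P <;> simp [h, hs]

open Classical in
-- The antiderivative `y / (1 + x y)` takes the values `1 / (x + G + 1)`, `1 / (x + 1)`, `1 / (x + G
-- - 1)` at `y = 2 - G, 1, G`. The rectangles overlap at most in the null line `y = 1`.
theorem lintegral_fiber (hα : α ∈ Icc g G) (x : ℝ) :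
    ∫⁻ y in {y | (x, y) ∈ Omega α}, ENNReal.ofReal (1 / (1 + x * y) ^ 2) =
      ENNReal.ofReal (marginalDensity α x) := by
  have h0 := pos_of_mem hα
  have h1 := lt_of_mem hα
  have hG := lt_G
  have hG' := G_lt
  have hgα := hα.1
  rw [g_eq] at hgα
  have hd1 : Disjoint {y | x ∈ I α ∧ y ∈ Ico 0 (2 - G)}
      {y | (x ∈ I α ∧ (1 - α) / α < x) ∧ y ∈ Ioc (2 - G) 1} := by
    rw [Set.disjoint_left]
    rintro y ⟨_, h⟩ ⟨_, h'⟩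
    linarith [h.2, h'.1]
  have hd2 : AEDisjoint volume ({y | x ∈ I α ∧ y ∈ Ico 0 (2 - G)} ∪
      {y | (x ∈ I α ∧ (1 - α) / α < x) ∧ y ∈ Ioc (2 - G) 1})
      {y | (x ∈ I α ∧ (α - 1) / (2 - α) ≤ x) ∧ y ∈ Ico 1 G} := by
    refine measure_mono_null (t := {1}) ?_ (by simp)
    rintro y ⟨h | h, h'⟩
    · linarith [h.2.2, h'.2.1]
    · exact le_antisymm h.2.2 h'.2.1
  rw [Omega_fiber hα, Measure.restrict_union₀ hd2 (measurableSet_and measurableSet_Ico).nullMeasurableSet,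
    lintegral_add_measure, lintegral_union (measurableSet_and measurableSet_Ioc) hd1,
    setLIntegral_and, setLIntegral_and, setLIntegral_and]
  by_cases hI : x ∈ I α
  swap
  · simp [hI, marginalDensity_of_notMem]
  have hx1 := hI.1
  have p1 : 0 < 1 + x * (2 - G) := by nlinarith
  have q1 := add_G_add_one_pos hα hI
  have v1 : (2 - G) / (1 + x * (2 - G)) = 1 / (x + G + 1) := by
    rw [div_eq_div_iff p1.ne' q1.ne']
    linear_combination -G_sq
  simp only [hI, true_and, if_true, marginalDensity]
  have i1 : ∫⁻ y in Ico 0 (2 - G), ENNReal.ofReal (1 / (1 + x * y) ^ 2) =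
      ENNReal.ofReal (1 / (x + G + 1)) := by
    rw [setLIntegral_congr Ico_ae_eq_Ioc,
      lintegral_fiber_Ioc (by linarith) (by linarith) p1, v1, zero_div, sub_zero]
  have i2 : (if (1 - α) / α < x then ∫⁻ y in Ioc (2 - G) 1, ENNReal.ofReal (1 / (1 + x * y) ^ 2)
      else 0) = ENNReal.ofReal
        (if (1 - α) / α < x then 1 / (x + 1) - 1 / (x + G + 1) else 0) := by
    split_ifs with h
    · have := add_one_pos_of_lt hα h
      rw [lintegral_fiber_Ioc (by linarith) p1 (by linarith), v1]
      congr 3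
      ring
    · simp
  have i3 : (if (α - 1) / (2 - α) ≤ x then ∫⁻ y in Ico 1 G, ENNReal.ofReal (1 / (1 + x * y) ^ 2)
      else 0) = ENNReal.ofReal
        (if (α - 1) / (2 - α) ≤ x then 1 / (x + G - 1) - 1 / (x + 1) else 0) := by
    split_ifs with h
    · have q2 := add_one_pos_of_le hα h
      have q3 := add_G_sub_one_pos hα h
      have e : 1 + x * G = G * (x + G - 1) := by linear_combination -G_sq
      have q4 : 0 < 1 + x * G := by rw [e]; positivity
      have e3 : G / (G * (x + G - 1)) = 1 / (x + G - 1) := by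
        have : G ≠ 0 := by linarith
        field_simp
      rw [setLIntegral_congr Ico_ae_eq_Ioc, lintegral_fiber_Ioc (by linarith) (by linarith) q4, e, e3,
        mul_one, add_comm 1 x]
    · simp
  have n2 : 0 ≤ (if (1 - α) / α < x then 1 / (x + 1) - 1 / (x + G + 1) else 0) := by
    split_ifs with h
    · rw [sub_nonneg]
      exact one_div_le_one_div_of_le (add_one_pos_of_lt hα h) (by linarith)
    · exact le_rfl
  have n3 : 0 ≤ (if (α - 1) / (2 - α) ≤ x then 1 / (x + G - 1) - 1 / (x + 1) else 0) := by
    split_ifs with h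
    · rw [sub_nonneg]
      exact one_div_le_one_div_of_le (add_G_sub_one_pos hα h) (by linarith)
    · exact le_rfl
  have n1 : 0 ≤ 1 / (x + G + 1) := by positivity
  rw [i1, i2, i3, ← ENNReal.ofReal_add n1 n2, ← ENNReal.ofReal_add (add_nonneg n1 n2) n3]

theorem measurableSet_Omega (α : ℝ) : MeasurableSet (Omega α) :=
  ((measurableSet_Ico.prod measurableSet_Ico).union
    (measurableSet_Ioo.prod measurableSet_Ioc)).union (measurableSet_Ico.prod measurableSet_Ico)

theorem mu_preimage_fst (hα : α ∈ Icc g G) {E : Set ℝ} (hE : MeasurableSet E) :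
    mu α (Prod.fst ⁻¹' E) = marginal α E := by
  have hm : Measurable fun p : ℝ × ℝ => ENNReal.ofReal (1 / (1 + p.1 * p.2) ^ 2) := by fun_prop
  have hE' : MeasurableSet (Prod.fst ⁻¹' E : Set (ℝ × ℝ)) := measurable_fst hE
  have hΩ := measurableSet_Omega α
  rw [mu, withDensity_apply _ hE', Measure.restrict_restrict hE',
    ← lintegral_indicator (hE'.inter hΩ), Measure.volume_eq_prod,
    lintegral_prod _ (hm.indicator (hE'.inter hΩ)).aemeasurable, marginal,
    withDensity_apply _ hE, ← lintegral_indicator hE]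
  refine lintegral_congr fun x => ?_
  by_cases hx : x ∈ E
  · rw [indicator_of_mem hx, ← lintegral_fiber hα,
      ← lintegral_indicator (show MeasurableSet {y | (x, y) ∈ Omega α} from
        measurable_prodMk_left hΩ)]
    refine lintegral_congr fun y => ?_
    classical
    simp [indicator_apply, hx]
  · rw [indicator_of_notMem hx]
    simp [hx]

theorem map_fst_muNormalized (hα : α ∈ Icc g G) :
    (muNormalized α).map Prod.fst = ENNReal.ofReal (3 * Real.log G)⁻¹ • marginal α := by
  ext E hE
  rw [Measure.map_apply measurable_fst hE, muNormalized, Measure.smul_apply, Measure.smul_apply,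
    mu_preimage_fst hα hE]

theorem marginal_compl_I (α : ℝ) : marginal α (I α)ᶜ = 0 := by
  have hI : MeasurableSet (I α)ᶜ := (measurableSet_Ico : MeasurableSet (Ico (α - 2) α)).compl
  rw [marginal, withDensity_apply _ hI]
  refine (setLIntegral_congr_fun hI fun x hx => ?_).trans lintegral_zero
  rw [marginalDensity_of_notMem hx, ENNReal.ofReal_zero]

theorem lintegral_Ioc_one_div_add {u a b : ℝ} (hab : a ≤ b) (hu : 0 < a + u) :
    ∫⁻ x in Ioc a b, ENNReal.ofReal (1 / (x + u)) =
      ENNReal.ofReal (Real.log (b + u) - Real.log (a + u)) := by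
  refine lintegral_Ioc_of_hasDerivAt (F := fun x => Real.log (x + u)) hab (fun x hx => ?_)
    fun x hx => one_div_nonneg.2 (by linarith [hx.1])
  exact ((hasDerivAt_id x).add_const u).log (by simp only [id]; linarith [hx.1])

theorem lintegral_Ioc_one_div_add_sub {u v a b : ℝ} (hab : a ≤ b) (hu : 0 < a + u) (huv : u ≤ v) :
    ∫⁻ x in Ioc a b, ENNReal.ofReal (1 / (x + u) - 1 / (x + v)) =
      ENNReal.ofReal (Real.log (b + u) - Real.log (b + v) -
        (Real.log (a + u) - Real.log (a + v))) := by
  refine lintegral_Ioc_of_hasDerivAt (F := fun x => Real.log (x + u) - Real.log (x + v)) hab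
    (fun x hx => ?_) fun x hx => ?_
  · exact (((hasDerivAt_id x).add_const u).log (by simp only [id]; linarith [hx.1])).sub
      (((hasDerivAt_id x).add_const v).log (by simp only [id]; linarith [hx.1]))
  · rw [sub_nonneg]
    exact one_div_le_one_div_of_le (by linarith [hx.1]) (by linarith)

theorem marginal_univ (hα : α ∈ Icc g G) : marginal α univ = ENNReal.ofReal (3 * Real.log G) := by
  have h0 := pos_of_mem hα
  have h1 := lt_of_mem hα
  have hG := lt_G
  have hG' := G_lt
  have hsq := sq_le_of_mem hα
  have hsq' := one_le_of_mem hα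
  have a1 := sub_two_le_image_right hα
  have a2 := sub_two_le_image_left hα
  set t₁ := (1 - α) / α with ht₁
  set t₂ := (α - 1) / (2 - α) with ht₂
  have b1 : t₁ ≤ α := by
    rw [ht₁, div_le_iff₀ (by linarith)]
    linarith
  have b2 : t₂ ≤ α := by
    rw [ht₂, div_le_iff₀ (by linarith)]
    linarith
  have hA : (α - 2 : ℝ) ≤ α := by linarith
  have hp0 : 0 < α - 2 + (G + 1) := by linarith
  have hp1 : 0 < t₁ + 1 := by
    have : t₁ + 1 = 1 / α := by rw [ht₁]; field_simp; ring
    rw [this]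
    positivity
  have hp2 : 0 < t₂ + (G - 1) := by
    have := add_G_sub_one_pos hα (le_refl t₂)
    linarith
  have hsplit : marginal α univ =
      (∫⁻ x in Ioc (α - 2) α, ENNReal.ofReal (1 / (x + (G + 1)))) +
      (∫⁻ x in Ioc t₁ α, ENNReal.ofReal (1 / (x + 1) - 1 / (x + (G + 1)))) +
      ∫⁻ x in Ioc t₂ α, ENNReal.ofReal (1 / (x + (G - 1)) - 1 / (x + 1)) := by
    have m2 : Measurable ((Ioc t₁ α).indicator fun x =>
        ENNReal.ofReal (1 / (x + 1) - 1 / (x + (G + 1)))) :=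
      Measurable.indicator (by fun_prop) measurableSet_Ioc
    have m3 : Measurable ((Ioc t₂ α).indicator fun x =>
        ENNReal.ofReal (1 / (x + (G - 1)) - 1 / (x + 1))) :=
      Measurable.indicator (by fun_prop) measurableSet_Ioc
    rw [marginal, withDensity_apply _ MeasurableSet.univ, Measure.restrict_univ,
      ← lintegral_indicator measurableSet_Ioc, ← lintegral_indicator measurableSet_Ioc,
      ← lintegral_indicator measurableSet_Ioc, ← lintegral_add_right _ m2,
      ← lintegral_add_right _ m3]
    refine lintegral_congr_ae ?_
    have hne : ∀ c : ℝ, ∀ᵐ x : ℝ, x ≠ c := fun c => by simp [ae_iff]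
    filter_upwards [hne (α - 2), hne α, hne t₂] with x x1 x2 x3
    simp only [indicator_apply, mem_Ioc]
    by_cases hI : x ∈ I α
    · have q1 := add_G_add_one_pos hα hI
      have c0 : α - 2 < x ∧ x ≤ α := ⟨lt_of_le_of_ne hI.1 x1.symm, hI.2.le⟩
      have c1 : (t₁ < x ∧ x ≤ α) ↔ t₁ < x := and_iff_left hI.2.le
      have c2 : (t₂ < x ∧ x ≤ α) ↔ t₂ ≤ x :=
        ⟨fun h => h.1.le, fun h => ⟨lt_of_le_of_ne h x3.symm, hI.2.le⟩⟩
      have n1 : 0 ≤ 1 / (x + (G + 1)) := one_div_nonneg.2 (by linarith)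
      have n2 : t₁ < x → 0 ≤ 1 / (x + 1) - 1 / (x + (G + 1)) := fun h => by
        rw [sub_nonneg]
        exact one_div_le_one_div_of_le (add_one_pos_of_lt hα h) (by linarith)
      have n3 : t₂ ≤ x → 0 ≤ 1 / (x + (G - 1)) - 1 / (x + 1) := fun h => by
        rw [sub_nonneg]
        exact one_div_le_one_div_of_le (by linarith [add_G_sub_one_pos hα h]) (by linarith)
      rw [if_pos c0, marginalDensity, if_pos hI]
      simp only [c1, c2, ← ht₁, ← ht₂, add_assoc, add_sub_assoc]
      split_ifs with h h' h'
      · rw [ENNReal.ofReal_add n1 (add_nonneg (n2 h) (n3 h')),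
          ENNReal.ofReal_add (n2 h) (n3 h')]
      · rw [add_zero, add_zero, ENNReal.ofReal_add n1 (n2 h)]
      · rw [zero_add, zero_add, ENNReal.ofReal_add n1 (n3 h')]
      · simp
    · have hx : ¬ (α - 2 < x ∧ x ≤ α) := fun h => hI ⟨h.1.le, lt_of_le_of_ne h.2 x2⟩
      have hx1 : ¬ (t₁ < x ∧ x ≤ α) := fun h => hx ⟨by linarith [h.1], h.2⟩
      have hx2 : ¬ (t₂ < x ∧ x ≤ α) := fun h => hx ⟨by linarith [h.1], h.2⟩
      rw [if_neg hx, if_neg hx1, if_neg hx2, marginalDensity_of_notMem hI]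
      simp
  have l1 : 0 ≤ Real.log (α + (G + 1)) - Real.log (α - 2 + (G + 1)) :=
    sub_nonneg.2 (Real.log_le_log hp0 (by linarith))
  have aux : ∀ {u v t : ℝ}, t ≤ α → 0 < t + u → u ≤ v →
      0 ≤ Real.log (α + u) - Real.log (α + v) - (Real.log (t + u) - Real.log (t + v)) := by
    intro u v t ht hu huv
    have := Real.log_le_log (mul_pos (show 0 < α + v by linarith) hu)
      (show (α + v) * (t + u) ≤ (α + u) * (t + v) by nlinarith)
    rw [Real.log_mul (by linarith) (by linarith), Real.log_mul (by linarith) (by linarith)] at this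
    linarith
  rw [hsplit, lintegral_Ioc_one_div_add hA hp0,
    lintegral_Ioc_one_div_add_sub b1 hp1 (by linarith),
    lintegral_Ioc_one_div_add_sub b2 hp2 (by linarith), ← ENNReal.ofReal_add l1
    (aux b1 hp1 (by linarith)), ← ENNReal.ofReal_add (add_nonneg l1 (aux b1 hp1 (by linarith)))
    (aux b2 hp2 (by linarith))]
  congr 1
  have hα0 : α ≠ 0 := by linarith
  have hα2 : 2 - α ≠ 0 := by linarith
  have hGα : 1 + G * α ≠ 0 := by nlinarith
  have e1 : t₁ + 1 = 1 / α := by rw [ht₁]; field_simp; ring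
  have e2 : t₁ + (G + 1) = (1 + G * α) / α := by rw [ht₁]; field_simp; ring
  have e3 : t₂ + 1 = 1 / (2 - α) := by rw [ht₂]; field_simp; ring
  -- The factor `1 + G α` cancels against `e2`, and `G ^ 3` is the source of `3 log G`.
  have e4 : t₂ + (G - 1) = (1 + G * α) / G ^ 3 / (2 - α) := by
    have : G ≠ 0 := by linarith
    have h3 : G ^ 3 = 2 * G + 1 := by linear_combination (G + 1) * G_sq
    have h4 : (α - 1) + (G - 1) * (2 - α) = (1 + G * α) / G ^ 3 := by
      rw [eq_div_iff (by positivity), h3]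
      linear_combination (4 - 2 * α) * G_sq
    rw [← h4, ht₂]
    field_simp
  have e5 : α - 2 + (G + 1) = α + (G - 1) := by ring
  rw [e1, e2, e3, e4, e5, Real.log_div one_ne_zero hα0, Real.log_div hGα hα0,
    Real.log_div one_ne_zero hα2, Real.log_div (div_ne_zero hGα (by positivity)) hα2,
    Real.log_div hGα (by positivity), Real.log_pow]
  push_cast
  ring

/-! ### From the line back to `I α` -/

/-- The representative of `x` modulo `2` in `I α`. -/
noncomputable def reduce (α x : ℝ) : ℝ := x - 2 * ⌊(x - α) / 2⌋ - 2

theorem reduce_add_two (α x : ℝ) : reduce α (x + 2) = reduce α x := by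
  have e : (x + 2 - α) / 2 = (x - α) / 2 + 1 := by ring
  rw [reduce, reduce, e, Int.floor_add_one]
  push_cast
  ring

theorem reduce_of_mem {x : ℝ} (hx : x ∈ I α) : reduce α x = x := by
  have : ⌊(x - α) / 2⌋ = -1 := by
    rw [Int.floor_eq_iff]
    push_cast
    constructor <;> linarith [hx.1, hx.2]
  rw [reduce, this]
  push_cast
  ring

theorem gaussFun_eq_reduce {x : ℝ} (hx : x ≠ 0) : gaussFun α x = reduce α (1 / |x| + 1) := by
  have e : 1 / (2 * |x|) + (1 - α) / 2 = (1 / |x| + 1 - α) / 2 := by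
    field_simp
    ring
  rw [gaussFun, if_neg hx, reduce, digit, e]
  push_cast
  ring

/-- The periodic lift `reduce α ⁻¹' A` is Gauss invariant because `gaussFun` is `reduce` of `1 / |x|
+ 1`. The Lebesgue zero-one law then transfers by absolute continuity. -/
theorem marginal_eq_zero_or (hα : α ∈ Icc g G) {A : Set ℝ} (hA : MeasurableSet A)
    (hinv : ∀ x ∈ I α, x ∈ A ↔ gaussFun α x ∈ A) :
    marginal α A = 0 ∨ marginal α Aᶜ = 0 := by
  have hac : marginal α ≪ volume := withDensity_absolutelyContinuous _ _
  have hB : IsGaussInvariant α (reduce α ⁻¹' A) := by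
    refine ⟨fun x => ?_, fun x hx hi => ?_⟩
    · rw [mem_preimage, mem_preimage, reduce_add_two]
    · rw [mem_preimage, mem_preimage, reduce_of_mem hx, ← gaussFun_eq_reduce hi.ne_zero,
        hinv x hx]
  have hm : Measurable (reduce α) := by
    have h1 : Measurable fun n : ℤ => (2 * n : ℝ) := measurable_from_top
    have h2 : Measurable fun x : ℝ => (x - α) / 2 := by fun_prop
    exact (measurable_id.sub (h1.comp (Int.measurable_floor.comp h2))).sub_const 2
  have key : ∀ s : Set ℝ, volume (reduce α ⁻¹' s) = 0 → marginal α s = 0 := by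
    intro s hs
    refine measure_mono_null (t := reduce α ⁻¹' s ∪ (I α)ᶜ) (fun x hx => ?_)
      (measure_union_null (hac hs) (marginal_compl_I α))
    by_cases hxI : x ∈ I α
    · left
      rwa [mem_preimage, reduce_of_mem hxI]
    · exact Or.inr hxI
  exact (hB.volume_eq_zero_or hα (hm hA)).imp (key A) (key Aᶜ)

theorem nu_apply (hα : α ∈ Icc g G) (s : Set (I α)) :
    nu α s = ENNReal.ofReal (3 * Real.log G)⁻¹ * marginal α (Subtype.val '' s) := by
  have hI : MeasurableSet (I α) := (measurableSet_Ico : MeasurableSet (Ico (α - 2) α))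
  rw [nu, (MeasurableEmbedding.subtype_coe hI).comap_apply,
    map_fst_muNormalized hα, Measure.smul_apply, smul_eq_mul]

theorem nu_univ (hα : α ∈ Icc g G) : nu α univ = 1 := by
  have hI : marginal α (I α) = marginal α univ :=
    measure_congr (ae_eq_univ.2 (marginal_compl_I α))
  have hlog : 0 < 3 * Real.log G := mul_pos (by norm_num) (Real.log_pos (by linarith [lt_G]))
  rw [nu_apply hα, image_univ, Subtype.range_coe, hI, marginal_univ hα,
    ← ENNReal.ofReal_mul (inv_nonneg.2 hlog.le), inv_mul_cancel₀ hlog.ne', ENNReal.ofReal_one]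

theorem measurePreserving_gaussMap (hα : α ∈ Icc g G) :
    MeasurePreserving (gaussMap α hα) (nu α) (nu α) := by
  have hm : Measurable (gaussMap α hα) :=
    ((measurable_gaussFun α).comp measurable_subtype_coe).subtype_mk
  have hI : MeasurableSet (I α) := (measurableSet_Ico : MeasurableSet (Ico (α - 2) α))
  refine ⟨hm, ?_⟩
  ext s hs
  have himg : (Subtype.val '' (gaussMap α hα ⁻¹' s) : Set ℝ) =
      gaussFun α ⁻¹' (Subtype.val '' s) ∩ I α := by
    ext x
    constructor
    · rintro ⟨y, hy, rfl⟩
      exact ⟨⟨_, hy, rfl⟩, y.2⟩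
    · rintro ⟨⟨z, hz, hzx⟩, hx⟩
      refine ⟨⟨x, hx⟩, ?_, rfl⟩
      have : gaussMap α hα ⟨x, hx⟩ = z := Subtype.ext hzx.symm
      rwa [mem_preimage, this]
  rw [Measure.map_apply hm hs, nu_apply hα, nu_apply hα, himg,
    measure_inter_conull (by simpa using marginal_compl_I α),
    marginal_preimage_gaussFun hα (hI.subtype_image hs)]

end AlphaOCF

theorem proposition15 (α : ℝ) (hα : α ∈ Set.Icc AlphaOCF.g AlphaOCF.G) :
    MeasureTheory.IsProbabilityMeasure (AlphaOCF.nu α) ∧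
      Ergodic (AlphaOCF.gaussMap α hα) (AlphaOCF.nu α) := by
  refine ⟨⟨AlphaOCF.nu_univ hα⟩, AlphaOCF.measurePreserving_gaussMap hα, ⟨fun s hs hinv => ?_⟩⟩
  have hI : MeasurableSet (AlphaOCF.I α) :=
    (measurableSet_Ico : MeasurableSet (Set.Ico (α - 2) α))
  have h := AlphaOCF.marginal_eq_zero_or hα (hI.subtype_image hs) fun x hx => by
    have h1 : (⟨x, hx⟩ : AlphaOCF.I α) ∈ s ↔ AlphaOCF.gaussMap α hα ⟨x, hx⟩ ∈ s := by
      rw [← Set.mem_preimage, hinv]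
    rw [← Subtype.val_injective.mem_set_image (s := s) (a := ⟨x, hx⟩),
      ← Subtype.val_injective.mem_set_image (s := s)] at h1
    exact h1
  rw [Filter.eventuallyConst_set']
  rcases h with h | h
  · left
    rw [MeasureTheory.ae_eq_empty, AlphaOCF.nu_apply hα, h, mul_zero]
  · right
    rw [MeasureTheory.ae_eq_univ, AlphaOCF.nu_apply hα]
    refine mul_eq_zero_of_right _ (MeasureTheory.measure_mono_null ?_ h)
    rintro _ ⟨x, hx, rfl⟩ ⟨y, hy, hyx⟩
    exact hx (Subtype.ext hyx ▸ hy)
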